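/- Let $\tilde W$ be a finite Coxeter group with simple reflections $s_1,\dots,s_n$, let $\Omega$ be a group acting on $\tilde W$ by automorphisms that preserve the set of simple reflections, and let $W=\Omega\ltimes\tilde W$ be the corresponding twisted finite Coxeter group, whose elements are written $w=\delta\tilde w$. Let $W$ act on the real reflection representation $V$ with basis of simple roots $\alpha_1,\dots,\alpha_n$ (elements of $\Omega$ permute the simple roots), let $\mathfrak R=\tilde W\{\alpha_1,\dots,\alpha_n\}$ be the set of roots, and let $\mathfrak R_+$, $\mathfrak R_-$ be the sets of positive and negative roots. For $w\in W$ put $\mathfrak R_w:=\{\beta\in\mathfrak R_+: w(\beta)\in\mathfrak R_-\}$ and $\ell(w):=|\mathfrak R_w|$, and let $\mathfrak R_{\mathrm{st}}^w$ be the set of roots whose orbit under $w$ consists solely of positive or solely of negative roots. Let $\mathrm{Br}^+_{\tilde W}$ be the (positive) braid monoid of $\tilde W$, with generators $b_1,\dots,b_n$, let $\mathrm{Br}^+=\Omega\ltimes\mathrm{Br}^+_{\tilde W}$, and let $b_w=\delta b_{\tilde w}\in\mathrm{Br}^+$ be the reduced braid of $w=\delta\tilde w$, where $b_{\tilde w}$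 is the product of the generators along a reduced word of $\tilde w$. For $b=\delta b_{i_l}\cdots b_{i_1}\in\mathrm{Br}^+$, let $$\mathfrak R_b:=\{\alpha_{i_1},\ s_{i_1}(\alpha_{i_2}),\ \dots,\ s_{i_1}\cdots s_{i_{l-1}}(\alpha_{i_l})\}$$ be its root inversion set, which does not depend on the decomposition. For $b=\delta\tilde b\in\mathrm{Br}^+$, let $\mathrm{DG}_1(b)=\mathrm{DG}(b)$ be the greatest common right divisor in $\mathrm{Br}^+_{\tilde W}$ of $\tilde b$ and $b_{w_\circ}$, where $w_\circ$ is the longest element of $\tilde W$; removing it on the right from $\tilde b$ and repeating the procedure yields the Deligne–Garside factors $\mathrm{DG}_i(b)$ for $i\ge1$ (which are eventually $1$). Put $\mathrm{DG}_{i\ge}(b):=\mathrm{DG}_i(b)\cdots\mathrm{DG}_1(b)$. The factors are identified with their images in $\tilde W$ when inversion sets, lengths and actions on roots are taken. **Proposition A.** Let $w\in W$. For every integer $d\ge1$ we have $\mathfrak R_{b_w^d}\subseteq\mathfrak R\setminus\mathfrak R_{\mathrm{st}}^w$. Moreover, for every $i\ge1$: (i) for every $d\ge 1$, $$\mathfrak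 R_{\mathrm{DG}_i(b_w^d)}\subseteq\mathfrak R_+\setminus\bigl(\mathrm{DG}_{i-1}(b_w^d)\cdots\mathrm{DG}_1(b_w^d)(\mathfrak R_{\mathrm{st}}^w)\bigr),$$ and in particular $$\mathfrak R_w\subseteq\mathfrak R_{\mathrm{DG}(b_w^d)}\subseteq\mathfrak R_+\setminus\mathfrak R_{\mathrm{st}}^w\qquad\text{and}\qquad \ell\bigl(\mathrm{DG}_i(b_w^d)\bigr)\le|\mathfrak R_+\setminus\mathfrak R_{\mathrm{st}}^w|;$$ (ii) if $d:=i\bigl(|\mathfrak R_+\setminus\mathfrak R_{\mathrm{st}}^w|-\ell(w)+1\bigr)$, then $\mathrm{DG}_{i\ge}(b_w^{d'})=\mathrm{DG}_{i\ge}(b_w^{d})$ for every integer $d'\ge d$. -/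

import Mathlib

namespace CoxeterMatrix

noncomputable section

variable {B : Type*} (M : CoxeterMatrix B)

/-- The linear form `v ↦ 2 (α_i, v)` on the real reflection representation `B →₀ ℝ` of Tits, with
basis of simple roots `α_j = Finsupp.single j 1` and `(α_i, α_j) = - cos (π / M i j)`.
(If `M i j = 0`, which encodes `∞`, then `π / 0 = 0` in Lean and the value is `- 1`, as usual.) -/
def coroot (i : B) : Module.Dual ℝ (B →₀ ℝ) :=
  Finsupp.linearCombination ℝ fun j ↦ 2 * -Real.cos (Real.pi / M i j)

theorem coroot_single (i j : B) :
    M.coroot i (Finsupp.single j 1) = 2 * -Real.cos (Real.pi / M i j) := by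
  simp [coroot]

theorem coroot_self (i : B) : M.coroot i (Finsupp.single i 1) = 2 := by
  simp [coroot_single]

/-- The reflection `v ↦ v - 2 (α_i, v) α_i` in the simple root `α_i`. -/
def simpleReflection (i : B) : (B →₀ ℝ) ≃ₗ[ℝ] (B →₀ ℝ) :=
  Module.reflection (M.coroot_self i)

theorem eval_S_mul_sin (θ : ℝ) (n : ℤ) (t : ℝ) (ht : t = 2 * Real.cos θ) :
    (Polynomial.Chebyshev.S ℝ n).eval t * Real.sin θ = Real.sin ((n + 1) * θ) := by
  rw [ht]
  exact_mod_cast Polynomial.Chebyshev.S_two_mul_real_cos θ n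

theorem chebyshev_arg (i j : B) :
    M.coroot i (Finsupp.single j 1) * M.coroot j (Finsupp.single i 1) - 2 =
      2 * Real.cos (2 * (Real.pi / M i j)) := by
  rw [coroot_single, coroot_single, M.symmetric j i, Real.cos_two_mul]
  ring

theorem sin_pos_of_three_le {m : ℕ} (hm : 3 ≤ m) : 0 < Real.sin (2 * (Real.pi / m)) := by
  have h3 : (3 : ℝ) ≤ m := by exact_mod_cast hm
  apply Real.sin_pos_of_pos_of_lt_pi
  · have := Real.pi_pos
    positivity
  · rw [mul_div_assoc', div_lt_iff₀ (by linarith)]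
    nlinarith [Real.pi_pos]

theorem isLiftable_simpleReflection : M.IsLiftable M.simpleReflection := by
  intro i j
  obtain h0 | h1 | h2 | h3 : M i j = 0 ∨ M i j = 1 ∨ M i j = 2 ∨ 3 ≤ M i j := by omega
  · simp [h0]
  · have hij : i = j := by
      by_contra h
      exact M.off_diagonal i j h h1
    subst hij
    rw [h1, pow_one]
    ext1 v
    exact Module.involutive_reflection (M.coroot_self i) v
  · have e1 : M.coroot i (Finsupp.single j 1) = 0 := by simp [coroot_single, h2]
    have e2 : M.coroot j (Finsupp.single i 1) = 0 := by
      simp [coroot_single, M.symmetric j i, h2]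
    rw [h2, pow_two]
    apply LinearEquiv.ext
    intro v
    simp only [LinearEquiv.mul_apply, simpleReflection, Module.reflection_apply, map_sub, map_smul,
      e1, e2, M.coroot_self, LinearEquiv.coe_one, id_eq]
    module
  · apply LinearEquiv.ext
    intro v
    have hs := (sin_pos_of_three_le h3).ne'
    have key := Module.reflection_mul_reflection_pow_apply (M.coroot_self i) (M.coroot_self j)
      (M i j) v
    have hS := fun n : ℤ ↦ eval_S_mul_sin _ n _ (M.chebyshev_arg i j)
    have hm0 : (M i j : ℝ) ≠ 0 := by
      have : M i j ≠ 0 := by omega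
      exact_mod_cast this
    obtain ⟨k, hk⟩ := Nat.even_or_odd' (M i j)
    rcases hk with hk | hk
    · have a1 : ((M i j : ℤ) - 2) / 2 = (k : ℤ) - 1 := by omega
      have a2 : ((M i j : ℤ) - 1) / 2 = (k : ℤ) - 1 := by omega
      have z : (Polynomial.Chebyshev.S ℝ ((k : ℤ) - 1)).eval
          (M.coroot i (Finsupp.single j 1) * M.coroot j (Finsupp.single i 1) - 2) = 0 := by
        refine (mul_eq_zero.1 ?_).resolve_right hs
        rw [hS]
        have : ((((k : ℤ) - 1 : ℤ) : ℝ) + 1) * (2 * (Real.pi / M i j)) = Real.pi := by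
          have hk' : (M i j : ℝ) = 2 * k := by exact_mod_cast hk
          push_cast
          field_simp
          linarith
        rw [this, Real.sin_pi]
      rw [a1, a2, z] at key
      simpa [simpleReflection] using key
    · have a1 : ((M i j : ℤ) - 2) / 2 = (k : ℤ) - 1 := by omega
      have a2 : ((M i j : ℤ) - 1) / 2 = (k : ℤ) := by omega
      have a3 : ((M i j : ℤ) - 3) / 2 = (k : ℤ) - 1 := by omega
      have a4 : (M i j : ℤ) / 2 = (k : ℤ) := by omega
      have z : (Polynomial.Chebyshev.S ℝ (k : ℤ)).eval
            (M.coroot i (Finsupp.single j 1) * M.coroot j (Finsupp.single i 1) - 2) +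
          (Polynomial.Chebyshev.S ℝ ((k : ℤ) - 1)).eval
            (M.coroot i (Finsupp.single j 1) * M.coroot j (Finsupp.single i 1) - 2) = 0 := by
        refine (mul_eq_zero.1 ?_).resolve_right hs
        rw [add_mul, hS, hS]
        have : (((k : ℤ) : ℝ) + 1) * (2 * (Real.pi / M i j)) =
            2 * Real.pi - ((((k : ℤ) - 1 : ℤ) : ℝ) + 1) * (2 * (Real.pi / M i j)) := by
          have hk' : (M i j : ℝ) = 2 * k + 1 := by exact_mod_cast hk
          push_cast
          field_simp
          linarith
        rw [this, Real.sin_two_pi_sub]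
        ring
      rw [a1, a2, a3, a4, z] at key
      simpa [simpleReflection] using key

/-- If `(r_i r_j) ^ n = 1` for simple reflections `r_i`, `r_j`, then `M i j` divides `n`. -/
theorem dvd_of_pow_eq_one (i j : B) (n : ℕ)
    (h : (M.simpleReflection i * M.simpleReflection j) ^ n = 1) : M i j ∣ n := by
  classical
  by_cases hij : i = j
  · subst hij; simp
  have hS := fun n : ℤ ↦ eval_S_mul_sin _ n _ (M.chebyshev_arg i j)
  have key := Module.reflection_mul_reflection_pow_apply_self (M.coroot_self i) (M.coroot_self j) n
  set t := M.coroot i (Finsupp.single j 1) * M.coroot j (Finsupp.single i 1) - 2 with ht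
  have h' : ((Module.reflection (M.coroot_self i) * Module.reflection (M.coroot_self j)) ^ n)
      (Finsupp.single i 1) = (Finsupp.single i 1 : B →₀ ℝ) := by
    have := congrArg (fun e : (B →₀ ℝ) ≃ₗ[ℝ] (B →₀ ℝ) ↦ e (Finsupp.single i 1)) h
    simpa [simpleReflection] using this
  rw [h'] at key
  have ki := congrArg (fun v : B →₀ ℝ ↦ v i) key
  have kj := congrArg (fun v : B →₀ ℝ ↦ v j) key
  simp [hij, Ne.symm hij, coroot_single, M.symmetric j i] at ki kj
  have h1 := M.off_diagonal i j hij
  obtain h0 | h2 | h3 : M i j = 0 ∨ M i j = 2 ∨ 3 ≤ M i j := by omega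
  · have t2 : t = 2 := by rw [ht, chebyshev_arg, h0]; simp
    rw [t2, h0] at kj
    simp [Polynomial.Chebyshev.S_eval_two] at kj
    simp [h0, kj]
  · have t2 : t = -2 := by rw [ht, chebyshev_arg, h2]; simp [mul_div_cancel₀]
    rw [t2] at ki
    simp only [Polynomial.Chebyshev.S_eval_neg_two, Int.negOnePow_sub, Int.negOnePow_one] at ki
    rw [h2]
    rw [← even_iff_two_dvd]
    by_contra hn
    rw [Nat.not_even_iff_odd] at hn
    rw [Int.negOnePow_odd _ (by exact_mod_cast hn)] at ki
    push_cast at ki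
    norm_num at ki
  · have hs := sin_pos_of_three_le h3
    have hm0 : (0 : ℝ) < M i j := by
      have : 0 < M i j := by omega
      exact_mod_cast this
    have hc : Real.cos (Real.pi / M i j) ≠ 0 := by
      apply ne_of_gt
      apply Real.cos_pos_of_mem_Ioo
      constructor
      · have : 0 < Real.pi / M i j := div_pos Real.pi_pos hm0
        linarith [Real.pi_pos]
      · have : (3 : ℝ) ≤ M i j := by exact_mod_cast h3
        exact div_lt_div_of_pos_left Real.pi_pos (by norm_num) (by linarith)
    have z : (Polynomial.Chebyshev.S ℝ ((n : ℤ) - 1)).eval t = 0 := kj.resolve_right hc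
    rw [z, add_zero] at ki
    have s0 := hS ((n : ℤ) - 1)
    have s1 := hS (n : ℤ)
    rw [z, zero_mul] at s0
    rw [← ki, one_mul] at s1
    push_cast at s0 s1
    rw [sub_add_cancel] at s0
    rw [add_mul, one_mul, Real.sin_add, ← s0, zero_mul, zero_add] at s1
    have c1 : Real.cos (n * (2 * (Real.pi / M i j))) = 1 := by
      have := mul_right_cancel₀ hs.ne' ((one_mul _).trans s1)
      exact this.symm
    obtain ⟨k, hk⟩ := (Real.cos_eq_one_iff _).1 c1
    have : (k : ℝ) * M i j = n := by
      have hp := Real.pi_ne_zero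
      field_simp at hk
      linarith
    have hZ : k * (M i j : ℤ) = n := by exact_mod_cast this
    exact Int.natCast_dvd_natCast.1 ⟨k, by rw [← hZ, mul_comm]⟩

/-- The defining relations of the braid monoid: `s_i s_j s_i ⋯ = s_j s_i s_j ⋯`, with `M i j`
factors on each side, for all `i`, `j` with `M i j` finite. -/
def braidRel (a b : FreeMonoid B) : Prop :=
  ∃ i j, M i j ≠ 0 ∧ a = FreeMonoid.ofList (CoxeterSystem.braidWord M i j) ∧
    b = FreeMonoid.ofList (CoxeterSystem.braidWord M j i)

/-- The (untwisted, positive) Artin-Tits braid monoid. -/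
abbrev BraidMonoid : Type _ := PresentedMonoid M.braidRel

variable {M}

/-- The positive braid `b_{i_l} ⋯ b_{i_1}` of a word `[i_l, …, i_1]`. -/
def braidOfWord (l : List B) : M.BraidMonoid := PresentedMonoid.mk M.braidRel (FreeMonoid.ofList l)

end

end CoxeterMatrix

namespace CoxeterSystem

noncomputable section

variable {B : Type*} {M : CoxeterMatrix B} {W : Type*} [Group W] (cs : CoxeterSystem M W)

/-- The real reflection representation (of Tits) of a Coxeter group. -/
def reflRep : W →* ((B →₀ ℝ) ≃ₗ[ℝ] (B →₀ ℝ)) :=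
  cs.lift ⟨M.simpleReflection, M.isLiftable_simpleReflection⟩

theorem reflRep_simple (i : B) : cs.reflRep (cs.simple i) = M.simpleReflection i :=
  cs.lift_apply_simple M.isLiftable_simpleReflection i

theorem orderOf_simple_mul_simple (i j : B) : orderOf (cs.simple i * cs.simple j) = M i j := by
  apply Nat.dvd_antisymm
  · exact orderOf_dvd_of_pow_eq_one (cs.simple_mul_simple_pow i j)
  · apply M.dvd_of_pow_eq_one
    rw [← cs.reflRep_simple, ← cs.reflRep_simple, ← map_mul, ← map_pow, pow_orderOf_eq_one, map_one]

theorem simple_injective : Function.Injective cs.simple := by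
  intro i j h
  by_contra hij
  apply M.off_diagonal i j hij
  rw [← cs.orderOf_simple_mul_simple, h, cs.simple_mul_simple_self, orderOf_one]

/-- The canonical projection `b ↦ w_b` from the braid monoid to the Coxeter group. -/
def ofBraid : M.BraidMonoid →* W :=
  PresentedMonoid.lift cs.simple (by
    rintro a b ⟨i, j, -, rfl, rfl⟩
    have := cs.wordProd_braidWord_eq i j
    simpa [wordProd, FreeMonoid.lift_apply] using this)

/-- The reduced braid `b_w` of an element `w` of the Coxeter group: the product in the braid monoid
of a reduced word of `w` (by Matsumoto's theorem this does not depend on the reduced word). -/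
def reducedBraid (w : W) : M.BraidMonoid :=
  CoxeterMatrix.braidOfWord (cs.exists_isReduced w).choose

/-- The longest element of a finite Coxeter group. -/
def longest [Finite W] : W := (Finite.exists_max cs.length).choose

/-- The sequence of roots
`(s_{i_1} ⋯ s_{i_{l-1}} α_{i_l}, …, s_{i_1} α_{i_2}, α_{i_1})` of a word `[i_l, …, i_1]`. -/
def rootInvSeq : List B → List (B →₀ ℝ)
  | [] => []
  | i :: l => cs.reflRep (cs.wordProd l)⁻¹ (Finsupp.single i 1) :: rootInvSeq l

end

end CoxeterSystem

/-- `b ≥ c`: the element `c` is a right divisor of `b`. -/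
def IsRightDivisor {N : Type*} [Monoid N] (c b : N) : Prop := ∃ a, b = a * c

/-- `g` is a greatest common right divisor of `a` and `b`. -/
def IsRightGCD {N : Type*} [Monoid N] (g a b : N) : Prop :=
  IsRightDivisor g a ∧ IsRightDivisor g b ∧
    ∀ c, IsRightDivisor c a → IsRightDivisor c b → IsRightDivisor c g

/-- The data of a twisted Coxeter group `Ω ⋉ W`: a Coxeter system on `W` and a group `Ω` acting on
`W` by automorphisms, each of which preserves the set of simple reflections. -/
structure TwistedCoxeterSystem {B : Type*} (M : CoxeterMatrix B) (W Ω : Type*) [Group W]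
    [Group Ω] where
  /-- the underlying Coxeter system -/
  cs : CoxeterSystem M W
  /-- the action of the twists -/
  φ : Ω →* MulAut W
  map_simple : ∀ δ i, ∃ j, φ δ (cs.simple i) = cs.simple j

namespace TwistedCoxeterSystem

noncomputable section

variable {B : Type*} {M : CoxeterMatrix B} {W Ω : Type*} [Group W] [Group Ω]
  (T : TwistedCoxeterSystem M W Ω)

/-- The twisted Coxeter group. In Mathlib's convention its element `⟨n, δ⟩` is the product `n δ`. -/
abbrev Grp : Type _ := W ⋊[T.φ] Ω

/-- The untwisted part `w̃` in the decomposition `w = δ w̃`. -/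
def untwisted (w : T.Grp) : W := T.φ w.right⁻¹ w.left

theorem inr_mul_inl_untwisted (w : T.Grp) :
    (SemidirectProduct.inr w.right * SemidirectProduct.inl (T.untwisted w) : T.Grp) = w := by
  ext <;> simp [untwisted]

/-! ### The action of the twists -/

/-- The permutation of the (indices of the) simple reflections given by a twist. -/
def simplePerm : Ω →* Equiv.Perm B :=
  MonoidHom.toHomPerm
    { toFun := fun δ i ↦ (T.map_simple δ i).choose
      map_one' := by
        funext i
        apply T.cs.simple_injective
        rw [← (T.map_simple 1 i).choose_spec, map_one]
        rfl
      map_mul' := by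
        intro δ ε
        funext i
        apply T.cs.simple_injective
        rw [← (T.map_simple (δ * ε) i).choose_spec, map_mul, MulAut.mul_apply,
          (T.map_simple ε i).choose_spec, (T.map_simple δ _).choose_spec]
        rfl : Ω →* Function.End B }

theorem φ_simple (δ : Ω) (i : B) :
    T.φ δ (T.cs.simple i) = T.cs.simple (T.simplePerm δ i) :=
  (T.map_simple δ i).choose_spec

theorem matrix_simplePerm (δ : Ω) (i j : B) :
    M (T.simplePerm δ i) (T.simplePerm δ j) = M i j := by
  rw [← T.cs.orderOf_simple_mul_simple, ← T.cs.orderOf_simple_mul_simple, ← φ_simple, ← φ_simple,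
    ← map_mul]
  exact orderOf_injective (T.φ δ).toMonoidHom (T.φ δ).injective _

/-- Twists permute the simple roots as prescribed, extended linearly. -/
def twistRep : Ω →* ((B →₀ ℝ) ≃ₗ[ℝ] (B →₀ ℝ)) where
  toFun δ := Finsupp.domLCongr (T.simplePerm δ)
  map_one' := by
    ext1 v
    ext b
    rw [map_one]
    simp [Equiv.Perm.one_def]
  map_mul' δ ε := by
    ext1 v
    ext b
    rw [map_mul]
    simp [Finsupp.domLCongr_apply, Equiv.Perm.mul_def]

theorem twistRep_single (δ : Ω) (i : B) :
    T.twistRep δ (Finsupp.single i 1) = Finsupp.single (T.simplePerm δ i) 1 := by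
  simp [twistRep]

/-- The action of the twisted Coxeter group on the real reflection representation. -/
def rep : T.Grp →* ((B →₀ ℝ) ≃ₗ[ℝ] (B →₀ ℝ)) :=
  SemidirectProduct.lift T.cs.reflRep T.twistRep (by
    intro δ
    apply T.cs.ext_simple
    intro i
    simp only [MonoidHom.comp_apply, MulEquiv.coe_toMonoidHom, MulAut.conj_apply, φ_simple,
      CoxeterSystem.reflRep_simple]
    rw [eq_mul_inv_iff_mul_eq]
    apply LinearEquiv.toLinearMap_injective
    apply Finsupp.lhom_ext'
    intro j
    apply LinearMap.ext_ring
    simp only [LinearMap.comp_apply, Finsupp.lsingle_apply, LinearEquiv.coe_coe,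
      LinearEquiv.mul_apply, CoxeterMatrix.simpleReflection, Module.reflection_apply, map_sub,
      map_smul, twistRep_single, CoxeterMatrix.coroot_single, matrix_simplePerm])

/-! ### Roots -/

/-- The root system: the orbits of the simple roots. -/
def roots : Set (B →₀ ℝ) := {β | ∃ (x : W) (i : B), β = T.cs.reflRep x (Finsupp.single i 1)}

/-- The positive roots: the roots with nonnegative coefficients with respect to the simple roots. -/
def posRoots : Set (B →₀ ℝ) := {β | β ∈ T.roots ∧ ∀ i, 0 ≤ β i}

/-- The negative roots. -/
def negRoots : Set (B →₀ ℝ) := {β | β ∈ T.roots ∧ ∀ i, β i ≤ 0}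

/-- The (right) inversion set of an element of the twisted Coxeter group. -/
def invSet (w : T.Grp) : Set (B →₀ ℝ) := {β | β ∈ T.posRoots ∧ T.rep w β ∈ T.negRoots}

/-- The length of an element of the twisted Coxeter group. -/
def len (w : T.Grp) : ℕ := (T.invSet w).ncard

/-- The stable roots of `w`: the roots whose `w`-orbit consists solely of positive or solely of
negative roots. -/
def stableRoots (w : T.Grp) : Set (B →₀ ℝ) :=
  {β | β ∈ T.roots ∧
    ((∀ k : ℤ, T.rep (w ^ k) β ∈ T.posRoots) ∨ (∀ k : ℤ, T.rep (w ^ k) β ∈ T.negRoots))}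

/-! ### The twisted braid monoid -/

/-- A twist acts on the braid monoid by permuting the generators. -/
def twistBraid (δ : Ω) : M.BraidMonoid →* M.BraidMonoid :=
  PresentedMonoid.lift (fun i ↦ PresentedMonoid.of M.braidRel (T.simplePerm δ i)) (by
    have key : ∀ (i j : B) (m : ℕ), FreeMonoid.lift
        (fun i ↦ PresentedMonoid.of M.braidRel (T.simplePerm δ i))
          (FreeMonoid.ofList (CoxeterSystem.alternatingWord i j m)) =
        PresentedMonoid.mk M.braidRel (FreeMonoid.ofList
          (CoxeterSystem.alternatingWord (T.simplePerm δ i) (T.simplePerm δ j) m)) := by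
      intro i j m
      induction m generalizing i j with
      | zero => simp [CoxeterSystem.alternatingWord]
      | succ m ih =>
        rw [CoxeterSystem.alternatingWord_succ, CoxeterSystem.alternatingWord_succ,
          List.concat_eq_append, List.concat_eq_append, FreeMonoid.ofList_append,
          FreeMonoid.ofList_append, map_mul, map_mul, ih]
        simp [PresentedMonoid.of]
    rintro a b ⟨i, j, hij, rfl, rfl⟩
    rw [key, key]
    apply PresentedMonoid.mk_eq_mk_of_rel
    refine ⟨T.simplePerm δ i, T.simplePerm δ j, ?_, ?_, ?_⟩
    · rwa [matrix_simplePerm]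
    · rw [CoxeterSystem.braidWord, matrix_simplePerm]
    · rw [CoxeterSystem.braidWord, matrix_simplePerm])

@[simp]
theorem twistBraid_of (δ : Ω) (i : B) : T.twistBraid δ (PresentedMonoid.of M.braidRel i) =
    PresentedMonoid.of M.braidRel (T.simplePerm δ i) := rfl

theorem twistBraid_one (b : M.BraidMonoid) : T.twistBraid 1 b = b := by
  have : T.twistBraid 1 = MonoidHom.id _ := by
    apply PresentedMonoid.ext
    intro i
    simp
  rw [this]
  rfl

theorem twistBraid_mul (δ ε : Ω) (b : M.BraidMonoid) :
    T.twistBraid (δ * ε) b = T.twistBraid δ (T.twistBraid ε b) := by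
  have : T.twistBraid (δ * ε) = (T.twistBraid δ).comp (T.twistBraid ε) := by
    apply PresentedMonoid.ext
    intro i
    simp
  rw [this]
  rfl

/-- The twisted braid monoid `Ω ⋉ Br⁺`; the element `⟨δ, b⟩` is the product `δ b`. -/
@[ext]
structure Br (T : TwistedCoxeterSystem M W Ω) where
  /-- the twist `δ` in `δ b` -/
  twist : Ω
  /-- the untwisted part `b` in `δ b` -/
  braid : M.BraidMonoid

/-- Multiplication `(δ b) (ε c) = (δ ε) (ε⁻¹(b) c)`. -/
instance : Monoid T.Br where
  one := ⟨1, 1⟩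
  mul x y := ⟨x.twist * y.twist, T.twistBraid y.twist⁻¹ x.braid * y.braid⟩
  mul_assoc x y z := by
    apply Br.ext
    · exact mul_assoc _ _ _
    · change T.twistBraid z.twist⁻¹ (T.twistBraid y.twist⁻¹ x.braid * y.braid) * z.braid =
        T.twistBraid (y.twist * z.twist)⁻¹ x.braid * (T.twistBraid z.twist⁻¹ y.braid * z.braid)
      rw [map_mul, mul_inv_rev, twistBraid_mul, mul_assoc]
  one_mul x := by
    apply Br.ext
    · exact one_mul _
    · change T.twistBraid x.twist⁻¹ 1 * x.braid = x.braid
      rw [map_one, one_mul]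
  mul_one x := by
    apply Br.ext
    · exact mul_one _
    · change T.twistBraid 1⁻¹ x.braid * 1 = x.braid
      rw [inv_one, twistBraid_one, mul_one]

/-- The reduced braid `b_w = δ b_{w̃}` of an element `w = δ w̃`. -/
def reducedBraid (w : T.Grp) : T.Br := ⟨w.right, T.cs.reducedBraid (T.untwisted w)⟩

/-- The (right) root inversion set of a twisted braid: the roots that occur in the inversion
sequence of a decomposition `δ b_{i_l} ⋯ b_{i_1}` of it. (This set is the same for each
decomposition; here the union over all of them is taken.) -/
def braidInvSet (b : T.Br) : Set (B →₀ ℝ) :=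
  {β | ∃ (δ : Ω) (l : List B), b = ⟨δ, CoxeterMatrix.braidOfWord l⟩ ∧ β ∈ T.cs.rootInvSeq l}

/-! ### The Deligne-Garside normal form -/

open Classical in
/-- The head `DG(b)` of a positive braid: its greatest common right divisor with Garside's
fundamental braid, the reduced braid of the longest element. -/
def head [Finite W] (b : M.BraidMonoid) : M.BraidMonoid :=
  if h : ∃ g, IsRightGCD g b (T.cs.reducedBraid T.cs.longest) then h.choose else 1

open Classical in
/-- What remains of a positive braid after removing its head on the right. -/
def remainder [Finite W] (b : M.BraidMonoid) : M.BraidMonoid :=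
  if h : ∃ c, b = c * T.head b then h.choose else 1

/-- The `i`-th Deligne-Garside factor `DG_i(b)` of `b = δ b̃`, for `i ≥ 1` (with value `1` at
`i = 0`): the head of the braid that remains of `b̃` after removing the head `i - 1` times. -/
def DG [Finite W] (b : T.Br) : ℕ → M.BraidMonoid
  | 0 => 1
  | i + 1 => T.head (T.remainder^[i] b.braid)

/-- The product `DG_i(b) ⋯ DG_2(b) DG_1(b)` of the first `i` Deligne-Garside factors. -/
def DGprod [Finite W] (b : T.Br) : ℕ → M.BraidMonoid
  | 0 => 1
  | i + 1 => T.DG b (i + 1) * DGprod b i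

/-- The projection from the (untwisted) braid monoid to the Coxeter group, seen inside of the
twisted Coxeter group. -/
def ofBraid (b : M.BraidMonoid) : T.Grp := SemidirectProduct.inl (T.cs.ofBraid b)

end

end TwistedCoxeterSystem

/-! ### The invariant bilinear form. -/

namespace CoxeterMatrix

variable {B : Type*} (M : CoxeterMatrix B)

/-! Roots enter the picture through Tits's theorem (`reflRep_single_nonneg`): an element sends a
simple root to a positive root exactly when its length increases. Hence the suffix order on the
Coxeter group is inclusion of inversion sets (`isSuffix_iff_invRoots_subset`). It has meets, so
every `x` has a greatest suffix `z = maxSuffix x v` for which `z * v` is reduced. Letting the braid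
monoid act on pairs (remainder, head) by absorbing `v` into the head computes the Deligne–Garside
factors: the head of `b * b_v` is `z * v`, where `x` is the head of `b` and `z = maxSuffix x v`, and
what is left of `x` is pushed into the remainder.

For (i), the root inversion set of a product is the union of that of the right factor and the
pullback of that of the left factor. Stable roots are permuted by `w` and are never inversions of
`w`, so none occurs in a power of `b_w` (`notMem_stableRoots_of_mem_braidRoots`). Inversions of a
Garside factor, pulled back through the earlier factors, are roots of the whole braid. The length
bound follows since the stable roots are symmetric under sign, so that translating them does not
increase the number of positive roots outside.

For (ii), induct on the number of factors. Suppose the first `i` factors are constant from the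
exponent `t` on. Multiplying by `b_w` on the right then pushes the same element `z`, of length
`ℓ(w)`, past these factors, so the next factors follow a recursion `y (d + 1) = F (y d)` with `F`
fixed. Multiplying on the left shows that they increase in the suffix order. Such a sequence is
constant as soon as it stalls once. From the exponent `t + 1` on its lengths lie between `ℓ(w)` and
the bound of (i), which leaves room for only that many increases (`eq_of_stabilizing`,
`garsideHead_iterate_pow_eq`). -/

theorem simpleReflection_apply (i : B) (v : B →₀ ℝ) :
    M.simpleReflection i v = v - M.coroot i v • Finsupp.single i 1 :=
  Module.reflection_apply v (M.coroot_self i)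

theorem simpleReflection_apply_of_ne {i j : B} (h : j ≠ i) (v : B →₀ ℝ) :
    M.simpleReflection i v j = v j := by
  simp [simpleReflection_apply, h.symm]

/-- Twice the invariant bilinear form of the reflection representation. -/
noncomputable def doubleForm : (B →₀ ℝ) →ₗ[ℝ] Module.Dual ℝ (B →₀ ℝ) :=
  Finsupp.linearCombination ℝ M.coroot

theorem doubleForm_single (i : B) : M.doubleForm (Finsupp.single i 1) = M.coroot i := by
  simp [doubleForm]

/-- This is the symmetry of the form, inherited from that of the Coxeter matrix. -/
theorem doubleForm_apply_single (v : B →₀ ℝ) (i : B) :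
    M.doubleForm v (Finsupp.single i 1) = M.coroot i v := by
  have : M.doubleForm.flip (Finsupp.single i 1) = M.coroot i := by
    apply Finsupp.lhom_ext'
    intro j
    apply LinearMap.ext_ring
    simp [doubleForm_single, coroot_single, M.symmetric j i]
  exact LinearMap.congr_fun this v

theorem doubleForm_simpleReflection (i : B) (v u : B →₀ ℝ) :
    M.doubleForm (M.simpleReflection i v) (M.simpleReflection i u) = M.doubleForm v u := by
  simp only [simpleReflection_apply, map_sub, map_smul, LinearMap.sub_apply, LinearMap.smul_apply,
    doubleForm_single, doubleForm_apply_single, coroot_self, smul_eq_mul]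
  ring

end CoxeterMatrix

/-! ### Positivity in the reflection representation. -/

namespace CoxeterSystem

variable {B : Type*} {M : CoxeterMatrix B} {W : Type*} [Group W] (cs : CoxeterSystem M W)

theorem matrix_ne_zero (cs : CoxeterSystem M W) [Finite W] (i j : B) : M i j ≠ 0 := by
  rw [← cs.orderOf_simple_mul_simple]
  exact (orderOf_pos _).ne'

theorem finite_index (cs : CoxeterSystem M W) [Finite W] : Finite B :=
  Finite.of_injective _ cs.simple_injective

theorem reflRep_mul_apply (x y : W) (v : B →₀ ℝ) :
    cs.reflRep (x * y) v = cs.reflRep x (cs.reflRep y v) := by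
  rw [map_mul, LinearEquiv.mul_apply]

theorem reflRep_one_apply (v : B →₀ ℝ) : cs.reflRep 1 v = v := by
  rw [map_one, LinearEquiv.coe_one, id]

@[simp]
theorem reflRep_inv_reflRep (x : W) (v : B →₀ ℝ) : cs.reflRep x⁻¹ (cs.reflRep x v) = v := by
  rw [← reflRep_mul_apply, inv_mul_cancel, reflRep_one_apply]

@[simp]
theorem reflRep_reflRep_inv (x : W) (v : B →₀ ℝ) : cs.reflRep x (cs.reflRep x⁻¹ v) = v := by
  rw [← reflRep_mul_apply, mul_inv_cancel, reflRep_one_apply]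

theorem reflRep_simple_apply (i : B) (v : B →₀ ℝ) :
    cs.reflRep (cs.simple i) v = v - M.coroot i v • Finsupp.single i 1 := by
  rw [reflRep_simple, M.simpleReflection_apply]

theorem reflRep_simple_self (i : B) :
    cs.reflRep (cs.simple i) (Finsupp.single i 1) = -Finsupp.single i 1 := by
  rw [reflRep_simple_apply, M.coroot_self]
  module

theorem reflRep_simple_apply_of_ne {i j : B} (h : j ≠ i) (v : B →₀ ℝ) :
    cs.reflRep (cs.simple i) v j = v j := by
  rw [reflRep_simple, M.simpleReflection_apply_of_ne h]

theorem doubleForm_reflRep (x : W) (v u : B →₀ ℝ) :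
    M.doubleForm (cs.reflRep x v) (cs.reflRep x u) = M.doubleForm v u := by
  induction x using cs.simple_induction generalizing v u with
  | simple i => rw [reflRep_simple, M.doubleForm_simpleReflection]
  | one => simp
  | mul x y hx hy => rw [reflRep_mul_apply, reflRep_mul_apply, hx, hy]

/-- In the plane of two simple roots the coefficients obey the recursion of `sin (k θ)` with `θ = π
/ M i j`. The factor `sin θ` on the left avoids a division. -/
theorem reflRep_alternatingWord (i j : B) (k : ℕ) :
    Real.sin (Real.pi / M i j) •
        cs.reflRep (cs.wordProd (alternatingWord i j k)) (Finsupp.single i 1) =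
      if Even k then Real.sin ((k + 1) * (Real.pi / M i j)) • Finsupp.single i (1 : ℝ) +
        Real.sin (k * (Real.pi / M i j)) • Finsupp.single j (1 : ℝ)
      else Real.sin (k * (Real.pi / M i j)) • Finsupp.single i (1 : ℝ) +
        Real.sin ((k + 1) * (Real.pi / M i j)) • Finsupp.single j (1 : ℝ) := by
  induction k with
  | zero => simp [alternatingWord]
  | succ k ih =>
    have key : ∀ θ : ℝ, Real.sin ((k + 1 + 1) * θ) =
        2 * Real.cos θ * Real.sin ((k + 1) * θ) - Real.sin (k * θ) := by
      intro θ
      have e1 : ((k : ℝ) + 1 + 1) * θ = (k + 1) * θ + θ := by ring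
      have e2 : (k : ℝ) * θ = (k + 1) * θ - θ := by ring
      rw [e1, e2, Real.sin_add, Real.sin_sub]
      ring
    rw [alternatingWord_succ', wordProd_cons, reflRep_mul_apply, ← map_smul, ih]
    by_cases hk : Even k
    · have hk' : ¬ Even (k + 1) := by simpa [Nat.even_add_one] using hk
      simp only [hk, hk', if_true, if_false, reflRep_simple_apply, map_add, map_smul,
        M.coroot_single, M.diagonal, M.symmetric j i]
      push_cast
      rw [key, div_one, Real.cos_pi]
      module
    · have hk' : Even (k + 1) := by simpa [Nat.even_add_one] using hk
      simp only [hk, hk', if_true, if_false, reflRep_simple_apply, map_add, map_smul,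
        M.coroot_single, M.diagonal]
      push_cast
      rw [key, div_one, Real.cos_pi]
      module

theorem sin_mul_nonneg {m k : ℕ} (hk : k ≤ m) : 0 ≤ Real.sin (k * (Real.pi / m)) := by
  rcases Nat.eq_zero_or_pos m with rfl | hm
  · simp
  apply Real.sin_nonneg_of_nonneg_of_le_pi
  · have := Real.pi_pos
    positivity
  · have h1 : (k : ℝ) ≤ m := by exact_mod_cast hk
    have h2 : (0 : ℝ) < m := by exact_mod_cast hm
    rw [mul_div_assoc', div_le_iff₀ h2, mul_comm]
    exact mul_le_mul_of_nonneg_left h1 Real.pi_pos.le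

theorem sin_pi_div_pos {m : ℕ} (hm : 2 ≤ m) : 0 < Real.sin (Real.pi / m) := by
  have h2 : (2 : ℝ) ≤ m := by exact_mod_cast hm
  apply Real.sin_pos_of_pos_of_lt_pi
  · have := Real.pi_pos
    positivity
  · exact div_lt_self Real.pi_pos (by linarith)

theorem exists_reflRep_alternatingWord_eq {i j : B} (hij : i ≠ j) {k : ℕ} (hk : k < M i j) :
    ∃ p q : ℝ, 0 ≤ p ∧ 0 ≤ q ∧
      cs.reflRep (cs.wordProd (alternatingWord i j k)) (Finsupp.single i 1) =
        p • Finsupp.single i (1 : ℝ) + q • Finsupp.single j (1 : ℝ) := by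
  have h1 := M.off_diagonal i j hij
  have hs : 0 < Real.sin (Real.pi / M i j) := sin_pi_div_pos (by omega)
  have h := cs.reflRep_alternatingWord i j k
  have n1 := sin_mul_nonneg hk.le
  have n2 := sin_mul_nonneg (show k + 1 ≤ M i j from hk)
  push_cast at n2
  rw [← eq_inv_smul_iff₀ hs.ne'] at h
  rw [h]
  split_ifs
  · exact ⟨_, _, mul_nonneg (inv_nonneg.2 hs.le) n2, mul_nonneg (inv_nonneg.2 hs.le) n1, by module⟩
  · exact ⟨_, _, mul_nonneg (inv_nonneg.2 hs.le) n1, mul_nonneg (inv_nonneg.2 hs.le) n2, by module⟩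

/-- Tits: if `i` is not a right descent of `w`, then `w α_i` is a nonnegative combination of simple
roots. -/
theorem reflRep_single_nonneg (hM : ∀ i j, M i j ≠ 0) (w : W) (i : B)
    (h : ¬ cs.IsRightDescent w i) (b : B) : 0 ≤ cs.reflRep w (Finsupp.single i 1) b := by
  classical
  induction hn : cs.length w using Nat.strong_induction_on generalizing w i b with
  | _ n ih =>
  subst hn
  by_cases hw : w = 1
  · rw [hw, reflRep_one_apply, Finsupp.single_apply]
    split_ifs <;> norm_num
  obtain ⟨j, hj⟩ := cs.exists_rightDescent_of_ne_one hw
  have hij : i ≠ j := by rintro rfl; exact h hj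
  -- Split off on the right the longest alternating word in `i`, `j` that ends in `j`, with lengths
  -- adding up. The left factor `v` then has neither `i` nor `j` as a descent, and induction applies
  -- to it.
  let P : ℕ → Prop := fun k ↦ ∃ v, w = v * cs.wordProd (alternatingWord i j k) ∧
    cs.length v + k = cs.length w
  have P1 : P 1 := by
    refine ⟨w * cs.simple j, ?_, (cs.isRightDescent_iff).1 hj⟩
    simp [alternatingWord, mul_assoc]
  have hlw : 1 ≤ cs.length w := by
    obtain ⟨v, -, hv⟩ := P1
    omega
  have Pk : P (Nat.findGreatest P (cs.length w)) := Nat.findGreatest_spec hlw P1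
  have hk1 : 1 ≤ Nat.findGreatest P (cs.length w) := Nat.le_findGreatest hlw P1
  have hmax : ¬ P (Nat.findGreatest P (cs.length w) + 1) := by
    intro hP
    have hle : Nat.findGreatest P (cs.length w) + 1 ≤ cs.length w := by
      obtain ⟨v, -, hv⟩ := hP
      omega
    have := Nat.le_findGreatest hle hP
    omega
  generalize Nat.findGreatest P (cs.length w) = k at Pk hk1 hmax
  obtain ⟨v, hwv, hlv⟩ := Pk
  -- Otherwise `w * s_i` is `v` times an alternating word with more than `M i j` letters; such a
  -- word is not reduced, so `w * s_i` would be too short.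
  have hkM : k < M i j := by
    by_contra hle
    have hji : M j i ≠ 0 := hM j i
    have hred := cs.not_isReduced_alternatingWord j i hji (m := k + 1)
      (by rw [M.symmetric j i]; omega)
    have e : w * cs.simple i = v * cs.wordProd (alternatingWord j i (k + 1)) := by
      rw [alternatingWord_succ, wordProd_concat, ← mul_assoc, ← hwv]
    have l1 := cs.length_mul_le v (cs.wordProd (alternatingWord j i (k + 1)))
    have l2 := cs.length_wordProd_le (alternatingWord j i (k + 1))
    rw [IsReduced] at hred
    rw [length_alternatingWord] at hred l2
    rw [← e, (cs.not_isRightDescent_iff).1 h] at l1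
    omega
  have d1 : ¬ cs.IsRightDescent v (if Even k then j else i) := by
    intro hd
    apply hmax
    refine ⟨v * cs.simple (if Even k then j else i), ?_, ?_⟩
    · rw [alternatingWord_succ', wordProd_cons, hwv]
      simp [mul_assoc]
    · have := (cs.isRightDescent_iff).1 hd
      omega
  -- This is the first letter of the alternating word; as a descent of `v` it would cancel and
  -- shorten `w`.
  have d2 : ¬ cs.IsRightDescent v (if Even k then i else j) := by
    intro hd
    obtain ⟨k', rfl⟩ : ∃ k', k = k' + 1 := ⟨k - 1, by omega⟩
    have e : w = v * cs.simple (if Even (k' + 1) then i else j) *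
        cs.wordProd (alternatingWord i j k') := by
      rw [hwv, alternatingWord_succ', wordProd_cons, mul_assoc]
      by_cases hk : Even k' <;> simp [hk, Nat.even_add_one]
    have l1 := cs.length_mul_le (v * cs.simple (if Even (k' + 1) then i else j))
      (cs.wordProd (alternatingWord i j k'))
    have l2 := cs.length_wordProd_le (alternatingWord i j k')
    rw [length_alternatingWord] at l2
    rw [← e] at l1
    have := (cs.isRightDescent_iff).1 hd
    omega
  have hdi : ¬ cs.IsRightDescent v i := by
    by_cases hk : Even k
    · simpa [hk] using d2
    · simpa [hk] using d1
  have hdj : ¬ cs.IsRightDescent v j := by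
    by_cases hk : Even k
    · simpa [hk] using d1
    · simpa [hk] using d2
  have hlt : cs.length v < cs.length w := by omega
  have ni := ih _ hlt v i hdi b rfl
  have nj := ih _ hlt v j hdj b rfl
  obtain ⟨p, q, hp, hq, e⟩ := cs.exists_reflRep_alternatingWord_eq hij hkM
  rw [hwv, reflRep_mul_apply, e]
  simp only [map_add, map_smul, Finsupp.add_apply, Finsupp.smul_apply, smul_eq_mul]
  positivity

theorem reflRep_single_ne_zero (w : W) (i : B) : cs.reflRep w (Finsupp.single i 1) ≠ 0 := by
  simp

section Finite

variable [Finite W]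

theorem reflRep_single_nonpos (w : W) (i : B) (h : cs.IsRightDescent w i) (b : B) :
    cs.reflRep w (Finsupp.single i 1) b ≤ 0 := by
  have := cs.reflRep_single_nonneg cs.matrix_ne_zero (w * cs.simple i) i
    ((cs.isRightDescent_iff_not_isRightDescent_mul).1 h) b
  rw [reflRep_mul_apply, reflRep_simple_self, map_neg, Finsupp.neg_apply] at this
  linarith

theorem isRightDescent_iff_reflRep_nonpos (w : W) (i : B) :
    cs.IsRightDescent w i ↔ ∀ b, cs.reflRep w (Finsupp.single i 1) b ≤ 0 := by
  refine ⟨cs.reflRep_single_nonpos w i, fun h ↦ ?_⟩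
  by_contra hd
  apply cs.reflRep_single_ne_zero w i
  ext b
  exact le_antisymm (h b) (cs.reflRep_single_nonneg cs.matrix_ne_zero w i hd b)

theorem not_isRightDescent_iff_reflRep_nonneg (w : W) (i : B) :
    ¬ cs.IsRightDescent w i ↔ ∀ b, 0 ≤ cs.reflRep w (Finsupp.single i 1) b := by
  refine ⟨cs.reflRep_single_nonneg cs.matrix_ne_zero w i, fun h hd ↦ ?_⟩
  apply cs.reflRep_single_ne_zero w i
  ext b
  exact le_antisymm (cs.reflRep_single_nonpos w i hd b) (h b)

end Finite

/-! ### Roots and their signs. -/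

/-- The roots: the orbits of the simple roots. -/
def IsRoot (β : B →₀ ℝ) : Prop := ∃ (x : W) (i : B), β = cs.reflRep x (Finsupp.single i 1)

theorem isRoot_single (i : B) : cs.IsRoot (Finsupp.single i 1) :=
  ⟨1, i, (cs.reflRep_one_apply _).symm⟩

variable {cs}

theorem IsRoot.reflRep {β : B →₀ ℝ} (h : cs.IsRoot β) (x : W) : cs.IsRoot (cs.reflRep x β) := by
  obtain ⟨y, i, rfl⟩ := h
  exact ⟨x * y, i, (cs.reflRep_mul_apply x y _).symm⟩

theorem IsRoot.neg {β : B →₀ ℝ} (h : cs.IsRoot β) : cs.IsRoot (-β) := by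
  obtain ⟨y, i, rfl⟩ := h
  exact ⟨y * cs.simple i, i, by rw [reflRep_mul_apply, reflRep_simple_self, map_neg]⟩

theorem IsRoot.ne_zero {β : B →₀ ℝ} (h : cs.IsRoot β) : β ≠ 0 := by
  obtain ⟨y, i, rfl⟩ := h
  simp

theorem IsRoot.nonneg_or_nonpos [Finite W] {β : B →₀ ℝ} (h : cs.IsRoot β) :
    (∀ b, 0 ≤ β b) ∨ ∀ b, β b ≤ 0 := by
  obtain ⟨y, i, rfl⟩ := h
  by_cases hd : cs.IsRightDescent y i
  · exact .inr (cs.reflRep_single_nonpos y i hd)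
  · exact .inl (cs.reflRep_single_nonneg cs.matrix_ne_zero y i hd)

theorem IsRoot.not_nonneg_and_nonpos {β : B →₀ ℝ} (h : cs.IsRoot β)
    (h1 : ∀ b, 0 ≤ β b) (h2 : ∀ b, β b ≤ 0) : False :=
  h.ne_zero (Finsupp.ext fun b ↦ le_antisymm (h2 b) (h1 b))

theorem IsRoot.doubleForm_self {β : B →₀ ℝ} (h : cs.IsRoot β) : M.doubleForm β β = 2 := by
  obtain ⟨y, i, rfl⟩ := h
  rw [doubleForm_reflRep, M.doubleForm_single, M.coroot_self]

/-- A simple reflection permutes the positive roots other than its simple root. -/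
theorem IsRoot.reflRep_simple_nonneg [Finite W] {β : B →₀ ℝ} (h : cs.IsRoot β)
    (h0 : ∀ b, 0 ≤ β b) {i : B} (hi : β ≠ Finsupp.single i 1) (b : B) :
    0 ≤ cs.reflRep (cs.simple i) β b := by
  revert b
  refine ((h.reflRep (cs.simple i)).nonneg_or_nonpos).resolve_right fun hneg ↦ hi ?_
  -- The reflection changes only the coordinate at `i`, so a change of sign forces the others to
  -- vanish; the norm of a root then fixes the remaining one.
  have hsup : β = β i • Finsupp.single i (1 : ℝ) := by
    ext b
    by_cases hb : b = i
    · simp [hb]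
    · have := hneg b
      rw [cs.reflRep_simple_apply_of_ne hb] at this
      simp [Ne.symm hb, le_antisymm this (h0 b)]
  have h2 := h.doubleForm_self
  rw [hsup, map_smul, map_smul, LinearMap.smul_apply, M.doubleForm_single, M.coroot_self] at h2
  simp only [smul_eq_mul] at h2
  have h1 : β i = 1 := by nlinarith [h0 i]
  rw [hsup, h1, one_smul]

end CoxeterSystem

/-! ### Inversion sets. -/

namespace CoxeterSystem

open CoxeterMatrix

variable {B : Type*} {M : CoxeterMatrix B} {W : Type*} [Group W] (cs : CoxeterSystem M W)

/-- The inversion set of `x`: the positive roots that `x` sends to negative roots. -/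
def invRoots (x : W) : Set (B →₀ ℝ) :=
  {β | cs.IsRoot β ∧ (∀ b, 0 ≤ β b) ∧ ∀ b, cs.reflRep x β b ≤ 0}

theorem single_mem_invRoots_iff [Finite W] {x : W} {i : B} :
    Finsupp.single i 1 ∈ cs.invRoots x ↔ cs.IsRightDescent x i := by
  rw [isRightDescent_iff_reflRep_nonpos]
  refine ⟨fun h ↦ h.2.2, fun h ↦ ⟨cs.isRoot_single i, fun b ↦ ?_, h⟩⟩
  classical
  rw [Finsupp.single_apply]
  split_ifs <;> norm_num

theorem invRoots_one : cs.invRoots 1 = ∅ := by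
  ext β
  simp only [Set.mem_empty_iff_false, iff_false]
  rintro ⟨h1, h2, h3⟩
  rw [reflRep_one_apply] at h3
  exact h1.not_nonneg_and_nonpos h2 h3

/-- The reflection `s_i` changes the sign of `x β` only if `x β = ± α_i`. For positive `β` the minus
sign is impossible, because `x⁻¹ α_i` is positive. -/
theorem invRoots_simple_mul [Finite W] {x : W} {i : B} (h : ¬ cs.IsLeftDescent x i) :
    cs.invRoots (cs.simple i * x) =
      insert (cs.reflRep x⁻¹ (Finsupp.single i 1)) (cs.invRoots x) := by
  have hpos : ∀ b, 0 ≤ cs.reflRep x⁻¹ (Finsupp.single i 1) b := by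
    rw [← not_isRightDescent_iff_reflRep_nonneg, isRightDescent_inv_iff]
    exact h
  ext β
  rw [Set.mem_insert_iff]
  constructor
  · rintro ⟨h1, h2, h3⟩
    rw [reflRep_mul_apply] at h3
    by_cases he : cs.reflRep x β = Finsupp.single i 1
    · left
      rw [← he, reflRep_inv_reflRep]
    · right
      refine ⟨h1, h2, ?_⟩
      refine ((h1.reflRep x).nonneg_or_nonpos).resolve_left fun h4 ↦ ?_
      exact ((h1.reflRep x).reflRep (cs.simple i)).not_nonneg_and_nonpos
        ((h1.reflRep x).reflRep_simple_nonneg h4 he) h3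
  · rintro (rfl | ⟨h1, h2, h3⟩)
    · refine ⟨(cs.isRoot_single i).reflRep _, hpos, fun b ↦ ?_⟩
      rw [reflRep_mul_apply, reflRep_reflRep_inv, reflRep_simple_self]
      classical
      rw [Finsupp.neg_apply, Finsupp.single_apply]
      split_ifs <;> norm_num
    · refine ⟨h1, h2, fun b ↦ ?_⟩
      by_cases he : -cs.reflRep x β = Finsupp.single i 1
      · have e : -β = cs.reflRep x⁻¹ (Finsupp.single i 1) := by
          rw [← he, map_neg, reflRep_inv_reflRep]
        exact (h1.not_nonneg_and_nonpos h2 fun b ↦ by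
          have := hpos b
          rw [← e, Finsupp.neg_apply] at this
          linarith).elim
      · have := (h1.reflRep x).neg.reflRep_simple_nonneg
          (fun b ↦ by simpa using h3 b) he b
        rw [map_neg, Finsupp.neg_apply] at this
        rw [reflRep_mul_apply]
        linarith

variable {cs} in
theorem IsReduced.of_cons {i : B} {l : List B} (h : cs.IsReduced (i :: l)) :
    cs.IsReduced l ∧ ¬ cs.IsLeftDescent (cs.wordProd l) i := by
  have h1 : cs.IsReduced l := h.drop 1
  refine ⟨h1, ?_⟩
  rw [not_isLeftDescent_iff, ← wordProd_cons, h.eq, h1.eq, List.length_cons]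

variable {cs} in
theorem IsReduced.of_append {l k : List B} (h : cs.IsReduced (l ++ k)) :
    cs.IsReduced l ∧ cs.IsReduced k ∧
      cs.length (cs.wordProd l * cs.wordProd k) =
        cs.length (cs.wordProd l) + cs.length (cs.wordProd k) := by
  have h1 := h.take l.length
  have h2 := h.drop l.length
  rw [List.take_left' rfl] at h1
  rw [List.drop_left' rfl] at h2
  refine ⟨h1, h2, ?_⟩
  rw [← wordProd_append, h.eq, h1.eq, h2.eq, List.length_append]

theorem isReduced_append_iff {l k : List B} (hl : cs.IsReduced l) (hk : cs.IsReduced k) :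
    cs.IsReduced (l ++ k) ↔ cs.length (cs.wordProd l * cs.wordProd k) =
      cs.length (cs.wordProd l) + cs.length (cs.wordProd k) := by
  rw [IsReduced, wordProd_append, hl.eq, hk.eq, List.length_append]

theorem rootInvSeq_append (l k : List B) : cs.rootInvSeq (l ++ k) =
    (cs.rootInvSeq l).map (cs.reflRep (cs.wordProd k)⁻¹) ++ cs.rootInvSeq k := by
  induction l with
  | nil => simp [rootInvSeq]
  | cons i l ih =>
    simp [rootInvSeq, ih, wordProd_append]

variable {cs} in
theorem IsReduced.mem_rootInvSeq_iff [Finite W] {l : List B} (h : cs.IsReduced l) {β : B →₀ ℝ} :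
    β ∈ cs.rootInvSeq l ↔ β ∈ cs.invRoots (cs.wordProd l) := by
  induction l with
  | nil => simp [rootInvSeq, invRoots_one]
  | cons i l ih =>
    obtain ⟨h1, h2⟩ := h.of_cons
    rw [wordProd_cons, cs.invRoots_simple_mul h2, rootInvSeq, List.mem_cons, ih h1,
      Set.mem_insert_iff]

theorem isRoot_of_mem_rootInvSeq {l : List B} {β : B →₀ ℝ} (h : β ∈ cs.rootInvSeq l) :
    cs.IsRoot β := by
  induction l with
  | nil => simp [rootInvSeq] at h
  | cons i l ih =>
    rw [rootInvSeq, List.mem_cons] at h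
    rcases h with rfl | h
    · exact (cs.isRoot_single i).reflRep _
    · exact ih h

theorem invRoots_finite_and_ncard [Finite W] (x : W) :
    (cs.invRoots x).Finite ∧ (cs.invRoots x).ncard = cs.length x := by
  obtain ⟨l, hl, rfl⟩ := cs.exists_isReduced x
  rw [hl.eq]
  induction l with
  | nil => simp [invRoots_one]
  | cons i l ih =>
    obtain ⟨h1, h2⟩ := hl.of_cons
    obtain ⟨f, c⟩ := ih h1
    rw [wordProd_cons, cs.invRoots_simple_mul h2]
    refine ⟨f.insert _, ?_⟩
    rw [Set.ncard_insert_of_notMem _ f, c, List.length_cons]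
    rintro ⟨-, -, h3⟩
    rw [reflRep_reflRep_inv] at h3
    have := h3 i
    rw [Finsupp.single_eq_same] at this
    linarith

/-! ### The weak order -/

/-- The (suffix) weak order: a reduced word of `y` is a suffix of a reduced word of `x`. -/
def IsSuffix (y x : W) : Prop := cs.length (x * y⁻¹) + cs.length y = cs.length x

theorem isSuffix_refl (x : W) : cs.IsSuffix x x := by simp [IsSuffix]

theorem one_isSuffix (x : W) : cs.IsSuffix 1 x := by simp [IsSuffix]

theorem isSuffix_mul_iff {x y : W} :
    cs.IsSuffix y (x * y) ↔ cs.length (x * y) = cs.length x + cs.length y := by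
  rw [IsSuffix, mul_inv_cancel_right, eq_comm]

variable {cs} in
theorem IsSuffix.trans {x y z : W} (h : cs.IsSuffix z y) (h' : cs.IsSuffix y x) :
    cs.IsSuffix z x := by
  unfold IsSuffix at *
  have e : x * z⁻¹ = (x * y⁻¹) * (y * z⁻¹) := by group
  have l1 := cs.length_mul_le (x * y⁻¹) (y * z⁻¹)
  have l2 := cs.length_mul_le (x * z⁻¹) z
  rw [← e] at l1
  rw [inv_mul_cancel_right] at l2
  omega

variable {cs} in
theorem IsSuffix.length_le {x y : W} (h : cs.IsSuffix y x) : cs.length y ≤ cs.length x := by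
  unfold IsSuffix at h
  omega

variable {cs} in
theorem IsSuffix.eq_of_length_le {x y : W} (h : cs.IsSuffix y x)
    (hl : cs.length x ≤ cs.length y) : y = x := by
  unfold IsSuffix at h
  have h0 : cs.length (x * y⁻¹) = 0 := by omega
  rw [length_eq_zero_iff] at h0
  exact (mul_inv_eq_one.1 h0).symm

theorem simple_isSuffix_iff {x : W} {i : B} :
    cs.IsSuffix (cs.simple i) x ↔ cs.IsRightDescent x i := by
  rw [IsSuffix, cs.isRightDescent_iff, inv_simple, length_simple]

theorem isSuffix_mul_simple_iff {x y : W} {i : B} (hx : cs.IsRightDescent x i)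
    (hy : cs.IsRightDescent y i) :
    cs.IsSuffix (y * cs.simple i) (x * cs.simple i) ↔ cs.IsSuffix y x := by
  rw [isRightDescent_iff] at hx hy
  have e : x * cs.simple i * (y * cs.simple i)⁻¹ = x * y⁻¹ := by group
  unfold IsSuffix
  rw [e]
  omega

/-- A suffix contributes the tail of the root inversion sequence of a reduced word. Conversely, a
descent of `y` is visible as a simple root in its inversion set, hence is a descent of `x`, and can
be stripped from both. -/
theorem isSuffix_iff_invRoots_subset [Finite W] {x y : W} :
    cs.IsSuffix y x ↔ cs.invRoots y ⊆ cs.invRoots x := by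
  constructor
  · intro h
    obtain ⟨u, rfl⟩ : ∃ u, x = u * y := ⟨x * y⁻¹, by group⟩
    rw [isSuffix_mul_iff] at h
    obtain ⟨l, hl, rfl⟩ := cs.exists_isReduced u
    obtain ⟨k, hk, rfl⟩ := cs.exists_isReduced y
    rw [← cs.isReduced_append_iff hl hk] at h
    intro β hβ
    rw [← wordProd_append, ← h.mem_rootInvSeq_iff, rootInvSeq_append]
    exact List.mem_append_right _ (hk.mem_rootInvSeq_iff.2 hβ)
  · intro h
    induction hn : cs.length y generalizing x y with
    | zero =>
      rw [length_eq_zero_iff] at hn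
      rw [hn]
      exact cs.one_isSuffix x
    | succ n ih =>
      have hy1 : y ≠ 1 := by
        rintro rfl
        simp at hn
      obtain ⟨i, hy⟩ := cs.exists_rightDescent_of_ne_one hy1
      have hx : cs.IsRightDescent x i :=
        cs.single_mem_invRoots_iff.1 (h (cs.single_mem_invRoots_iff.2 hy))
      rw [← cs.isSuffix_mul_simple_iff hx hy]
      apply ih
      · rintro β ⟨h1, h2, h3⟩
        -- The root `α_i` is no longer an inversion after stripping, so `s_i` keeps `β` positive and
        -- makes it an inversion of `y`.
        have hne : β ≠ Finsupp.single i 1 := by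
          rintro rfl
          refine ((cs.isRoot_single i).reflRep (y * cs.simple i)).not_nonneg_and_nonpos
            (fun b ↦ ?_) h3
          have := cs.reflRep_single_nonpos y i hy b
          rw [reflRep_mul_apply, reflRep_simple_self, map_neg, Finsupp.neg_apply]
          linarith
        rw [reflRep_mul_apply] at h3
        have := h ⟨h1.reflRep (cs.simple i), h1.reflRep_simple_nonneg h2 hne, h3⟩
        refine ⟨h1, h2, fun b ↦ ?_⟩
        rw [reflRep_mul_apply]
        exact this.2.2 b
      · have := cs.isRightDescent_iff.1 hy
        omega

/-! ### Dihedral elements -/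

theorem reflRep_wordProd_apply_of_notMem {l : List B} {b : B} (hb : b ∉ l) (v : B →₀ ℝ) :
    cs.reflRep (cs.wordProd l) v b = v b := by
  induction l with
  | nil => simp
  | cons i l ih =>
    rw [List.mem_cons, not_or] at hb
    rw [wordProd_cons, reflRep_mul_apply, cs.reflRep_simple_apply_of_ne hb.1, ih hb.2]

theorem apply_eq_zero_of_mem_rootInvSeq {l : List B} {b : B} (hb : b ∉ l) {β : B →₀ ℝ}
    (h : β ∈ cs.rootInvSeq l) : β b = 0 := by
  induction l with
  | nil => simp [rootInvSeq] at h
  | cons i l ih =>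
    rw [List.mem_cons, not_or] at hb
    rw [rootInvSeq, List.mem_cons] at h
    rcases h with rfl | h
    · rw [← wordProd_reverse, cs.reflRep_wordProd_apply_of_notMem (by simpa using hb.2)]
      simp [Ne.symm hb.1]
    · exact ih hb.2 h

theorem mem_alternatingWord {i j b : B} {m : ℕ} (h : b ∈ alternatingWord i j m) :
    b = i ∨ b = j := by
  induction m generalizing i j with
  | zero => simp [alternatingWord] at h
  | succ m ih =>
    rw [alternatingWord_succ, List.concat_eq_append, List.mem_append, List.mem_singleton] at h
    rcases h with h | h
    · exact (ih h).symm
    · exact .inr h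

theorem isReduced_concat_iff {l : List B} (hl : cs.IsReduced l) {i : B} :
    cs.IsReduced (l.concat i) ↔ ¬ cs.IsRightDescent (cs.wordProd l) i := by
  rw [IsReduced, wordProd_concat, not_isRightDescent_iff, hl.eq, List.length_concat]

theorem isReduced_alternatingWord [Finite W] {i j : B} (hij : i ≠ j) {m : ℕ} (hm : m ≤ M i j) :
    cs.IsReduced (alternatingWord i j m) := by
  induction m generalizing i j with
  | zero => simp [alternatingWord, IsReduced]
  | succ m ih =>
    rw [M.symmetric i j] at hm
    rw [alternatingWord_succ, cs.isReduced_concat_iff (ih hij.symm (by omega)),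
      not_isRightDescent_iff_reflRep_nonneg]
    intro b
    obtain ⟨p, q, hp, hq, e⟩ := cs.exists_reflRep_alternatingWord_eq hij.symm (k := m) hm
    classical
    rw [e]
    simp only [Finsupp.add_apply, Finsupp.smul_apply, smul_eq_mul, Finsupp.single_apply]
    split_ifs <;> simp [hp, hq, add_nonneg]

theorem isReduced_braidWord [Finite W] {i j : B} (hij : i ≠ j) :
    cs.IsReduced (braidWord M i j) :=
  cs.isReduced_alternatingWord hij le_rfl

theorem isRightDescent_wordProd_braidWord [Finite W] {i j : B} (hij : i ≠ j) :
    cs.IsRightDescent (cs.wordProd (braidWord M i j)) j := by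
  have hr := cs.isReduced_braidWord hij
  rw [braidWord] at hr ⊢
  obtain ⟨m, hm⟩ : ∃ m, M i j = m + 1 := Nat.exists_eq_succ_of_ne_zero (cs.matrix_ne_zero i j)
  rw [hm, alternatingWord_succ] at hr ⊢
  have hr' : cs.IsReduced (alternatingWord j i m) :=
    cs.isReduced_alternatingWord hij.symm (by rw [M.symmetric j i]; omega)
  rw [isReduced_concat_iff _ hr'] at hr
  rwa [isRightDescent_iff_not_isRightDescent_mul, wordProd_concat, mul_assoc,
    simple_mul_simple_self, mul_one]

/-- The inversions of the longest dihedral element are nonnegative combinations of `α_i` and `α_j`,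
and `x` makes both of these negative. -/
theorem wordProd_braidWord_isSuffix [Finite W] {i j : B} (hij : i ≠ j) {x : W}
    (hi : cs.IsRightDescent x i) (hj : cs.IsRightDescent x j) :
    cs.IsSuffix (cs.wordProd (braidWord M i j)) x := by
  rw [isSuffix_iff_invRoots_subset]
  intro β hβ
  have hmem := (cs.isReduced_braidWord hij).mem_rootInvSeq_iff.2 hβ
  refine ⟨hβ.1, hβ.2.1, fun b ↦ ?_⟩
  have e : β = β i • Finsupp.single i (1 : ℝ) + β j • Finsupp.single j (1 : ℝ) := by
    ext c
    by_cases h1 : c = i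
    · subst h1
      simp [hij]
    by_cases h2 : c = j
    · subst h2
      simp [Ne.symm hij]
    have h3 : c ∉ braidWord M i j := fun h ↦ (mem_alternatingWord h).elim h1 h2
    rw [cs.apply_eq_zero_of_mem_rootInvSeq h3 hmem]
    simp [Ne.symm h1, Ne.symm h2]
  have ni := mul_nonpos_of_nonneg_of_nonpos (hβ.2.1 i) (cs.reflRep_single_nonpos x i hi b)
  have nj := mul_nonpos_of_nonneg_of_nonpos (hβ.2.1 j) (cs.reflRep_single_nonpos x j hj b)
  rw [e]
  simp only [map_add, map_smul, Finsupp.add_apply, Finsupp.smul_apply, smul_eq_mul]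
  simpa using add_nonpos ni nj

/-! ### Matsumoto's theorem -/

theorem braidOfWord_append (l k : List B) :
    (braidOfWord (l ++ k) : M.BraidMonoid) = braidOfWord l * braidOfWord k := by
  rw [braidOfWord, FreeMonoid.ofList_append, map_mul]
  rfl

theorem braidOfWord_braidWord (i j : B) (h : M i j ≠ 0) :
    (braidOfWord (braidWord M i j) : M.BraidMonoid) = braidOfWord (braidWord M j i) :=
  PresentedMonoid.mk_eq_mk_of_rel ⟨i, j, h, rfl, rfl⟩

/-- Matsumoto's theorem: reduced words of the same element give the same positive braid. -/
theorem braidOfWord_eq_of_isReduced [Finite W] {l k : List B} (hl : cs.IsReduced l)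
    (hk : cs.IsReduced k) (h : cs.wordProd l = cs.wordProd k) :
    (braidOfWord l : M.BraidMonoid) = braidOfWord k := by
  have hlen : l.length = k.length := by rw [← hl.eq, ← hk.eq, h]
  induction hn : l.length generalizing l k with
  | zero =>
    rw [hn] at hlen
    rw [List.length_eq_zero_iff.1 hn, List.length_eq_zero_iff.1 hlen.symm]
  | succ n ih =>
    rcases List.eq_nil_or_concat l with rfl | ⟨l, i, rfl⟩
    · simp at hn
    rcases List.eq_nil_or_concat k with rfl | ⟨k, j, rfl⟩
    · simp at hlen
    simp only [List.length_concat] at hn hlen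
    have hl' : cs.IsReduced l := (by simpa using hl : cs.IsReduced (l ++ [i])).of_append.1
    have hk' : cs.IsReduced k := (by simpa using hk : cs.IsReduced (k ++ [j])).of_append.1
    have dl : cs.IsRightDescent (cs.wordProd (l.concat i)) i := by
      rw [isRightDescent_iff_not_isRightDescent_mul, wordProd_concat, mul_assoc,
        simple_mul_simple_self, mul_one]
      exact (cs.isReduced_concat_iff hl').1 hl
    have dk : cs.IsRightDescent (cs.wordProd (k.concat j)) j := by
      rw [isRightDescent_iff_not_isRightDescent_mul, wordProd_concat, mul_assoc,
        simple_mul_simple_self, mul_one]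
      exact (cs.isReduced_concat_iff hk').1 hk
    by_cases hij : i = j
    · subst hij
      rw [wordProd_concat, wordProd_concat] at h
      rw [List.concat_eq_append, List.concat_eq_append, braidOfWord_append, braidOfWord_append,
        ih hl' hk' (mul_right_cancel h) (by omega) (by omega)]
    -- With distinct last letters, both are descents, so the element ends in the longest dihedral
    -- element. Each given word can be compared by induction with a word `u ++ braidWord` having the
    -- same last letter; the two comparison words differ by one braid relation.
    · have key : ∀ {i j : B} {l : List B}, i ≠ j → cs.IsReduced (l.concat j) →
          cs.IsReduced l → l.length = n →
          cs.IsRightDescent (cs.wordProd (l.concat j)) i →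
          cs.IsRightDescent (cs.wordProd (l.concat j)) j →
          ∀ u, cs.IsReduced u → cs.wordProd u = cs.wordProd (l.concat j) *
            (cs.wordProd (braidWord M i j))⁻¹ →
          (braidOfWord (l.concat j) : M.BraidMonoid) = braidOfWord (u ++ braidWord M i j) := by
        intro i j l hij hlj hl hn di dj u hu e
        have hsuf := cs.wordProd_braidWord_isSuffix hij di dj
        have hred : cs.IsReduced (u ++ braidWord M i j) := by
          rw [cs.isReduced_append_iff hu (cs.isReduced_braidWord hij), e, inv_mul_cancel_right]
          exact hsuf.symm
        have hprod : cs.wordProd (u ++ braidWord M i j) = cs.wordProd (l.concat j) := by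
          rw [wordProd_append, e, inv_mul_cancel_right]
        rw [braidWord] at hred hprod ⊢
        obtain ⟨m, hm⟩ : ∃ m, M i j = m + 1 :=
          Nat.exists_eq_succ_of_ne_zero (cs.matrix_ne_zero i j)
        rw [hm, alternatingWord_succ] at hred hprod ⊢
        simp only [List.concat_eq_append] at hred hprod ⊢
        rw [← List.append_assoc] at hred hprod ⊢
        rw [braidOfWord_append, braidOfWord_append (u ++ _)]
        congr 1
        have hred' := hred.of_append.1
        have hprod' : cs.wordProd l = cs.wordProd (u ++ alternatingWord j i m) := by
          rw [wordProd_append, wordProd_append _ l] at hprod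
          exact (mul_right_cancel hprod).symm
        refine ih hl hred' hprod' ?_ hn
        rw [← hl.eq, ← hred'.eq, hprod']
      obtain ⟨u, hu, hue⟩ := cs.exists_isReduced
        (cs.wordProd (k.concat j) * (cs.wordProd (braidWord M i j))⁻¹)
      rw [key hij hk hk' (by omega) (h ▸ dl) dk u hu hue.symm,
        key (Ne.symm hij) hl hl' (by omega) (h ▸ dk) dl u hu
          (by rw [← hue, h, cs.wordProd_braidWord_eq]),
        braidOfWord_append, braidOfWord_append, braidOfWord_braidWord i j (cs.matrix_ne_zero i j)]

theorem reducedBraid_wordProd [Finite W] {l : List B} (hl : cs.IsReduced l) :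
    cs.reducedBraid (cs.wordProd l) = braidOfWord l :=
  cs.braidOfWord_eq_of_isReduced (cs.exists_isReduced (cs.wordProd l)).choose_spec.1 hl
    (cs.exists_isReduced (cs.wordProd l)).choose_spec.2.symm

theorem reducedBraid_mul [Finite W] {x y : W}
    (h : cs.length (x * y) = cs.length x + cs.length y) :
    cs.reducedBraid (x * y) = cs.reducedBraid x * cs.reducedBraid y := by
  obtain ⟨l, hl, rfl⟩ := cs.exists_isReduced x
  obtain ⟨k, hk, rfl⟩ := cs.exists_isReduced y
  rw [cs.reducedBraid_wordProd hl, cs.reducedBraid_wordProd hk, ← wordProd_append,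
    cs.reducedBraid_wordProd ((cs.isReduced_append_iff hl hk).2 h), braidOfWord_append]

theorem reducedBraid_one [Finite W] : cs.reducedBraid 1 = 1 := by
  have : cs.IsReduced [] := by simp [IsReduced]
  exact cs.wordProd_nil ▸ cs.reducedBraid_wordProd this

theorem reducedBraid_simple [Finite W] (i : B) :
    cs.reducedBraid (cs.simple i) = PresentedMonoid.of M.braidRel i := by
  have : cs.IsReduced [i] := by simp [IsReduced]
  exact cs.wordProd_singleton i ▸ cs.reducedBraid_wordProd this

theorem ofBraid_braidOfWord (l : List B) : cs.ofBraid (braidOfWord l) = cs.wordProd l := by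
  induction l with
  | nil => rw [wordProd_nil]; exact map_one _
  | cons i l ih =>
    rw [← List.singleton_append, braidOfWord_append, map_mul, ih, wordProd_append,
      wordProd_singleton]
    rfl

theorem ofBraid_reducedBraid (x : W) : cs.ofBraid (cs.reducedBraid x) = x := by
  rw [reducedBraid, ofBraid_braidOfWord]
  exact (cs.exists_isReduced x).choose_spec.2.symm

end CoxeterSystem

namespace CoxeterSystem

open CoxeterMatrix

variable {B : Type*} {M : CoxeterMatrix B} {W : Type*} [Group W] (cs : CoxeterSystem M W)

/-! ### Meets in the weak order -/

variable {cs} in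
theorem IsSuffix.isRightDescent {x y : W} (h : cs.IsSuffix y x) {i : B}
    (hi : cs.IsRightDescent y i) : cs.IsRightDescent x i := by
  rw [← simple_isSuffix_iff] at hi ⊢
  exact hi.trans h

theorem isRightDescent_mul_simple {x : W} {i : B} (h : ¬ cs.IsRightDescent x i) :
    cs.IsRightDescent (x * cs.simple i) i := by
  rwa [isRightDescent_iff_not_isRightDescent_mul, simple_mul_simple_cancel_right]

/-- Two common lower bounds in the weak order lie below a common lower bound. -/
theorem exists_isSuffix_of_isSuffix [Finite W] {x x' y y' : W} (h1 : cs.IsSuffix y x)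
    (h2 : cs.IsSuffix y x') (h3 : cs.IsSuffix y' x) (h4 : cs.IsSuffix y' x') :
    ∃ u, cs.IsSuffix u x ∧ cs.IsSuffix u x' ∧ cs.IsSuffix y u ∧ cs.IsSuffix y' u := by
  induction hn : cs.length x generalizing x x' y y' with
  | zero =>
    have := h3.length_le
    have e : y' = 1 := by rw [← cs.length_eq_zero_iff]; omega
    exact ⟨y, h1, h2, cs.isSuffix_refl y, e ▸ cs.one_isSuffix y⟩
  | succ n ih =>
    -- If the two lower bounds share a descent, strip it from all four elements, apply induction,
    -- and put it back.
    have key : ∀ {y y' : W} {i : B}, cs.IsSuffix y x → cs.IsSuffix y x' → cs.IsSuffix y' x →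
        cs.IsSuffix y' x' → cs.IsRightDescent y i → cs.IsRightDescent y' i →
        ∃ u, cs.IsSuffix u x ∧ cs.IsSuffix u x' ∧ cs.IsSuffix y u ∧ cs.IsSuffix y' u := by
      intro y y' i h1 h2 h3 h4 hy hy'
      have hx := h1.isRightDescent hy
      have hx' := h2.isRightDescent hy
      obtain ⟨u, a1, a2, a3, a4⟩ := ih ((cs.isSuffix_mul_simple_iff hx hy).2 h1)
        ((cs.isSuffix_mul_simple_iff hx' hy).2 h2) ((cs.isSuffix_mul_simple_iff hx hy').2 h3)
        ((cs.isSuffix_mul_simple_iff hx' hy').2 h4)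
        (by have := cs.isRightDescent_iff.1 hx; omega)
      have hu : cs.IsRightDescent (u * cs.simple i) i :=
        cs.isRightDescent_mul_simple fun h ↦
          (cs.isRightDescent_iff_not_isRightDescent_mul.1 hx) (a1.isRightDescent h)
      refine ⟨u * cs.simple i, ?_, ?_, ?_, ?_⟩
      · rwa [← cs.isSuffix_mul_simple_iff hx hu, simple_mul_simple_cancel_right]
      · rwa [← cs.isSuffix_mul_simple_iff hx' hu, simple_mul_simple_cancel_right]
      · rwa [← cs.isSuffix_mul_simple_iff hu hy, simple_mul_simple_cancel_right]
      · rwa [← cs.isSuffix_mul_simple_iff hu hy', simple_mul_simple_cancel_right]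
    by_cases hy1 : y = 1
    · exact ⟨y', h3, h4, hy1 ▸ cs.one_isSuffix y', cs.isSuffix_refl y'⟩
    by_cases hy1' : y' = 1
    · exact ⟨y, h1, h2, cs.isSuffix_refl y, hy1' ▸ cs.one_isSuffix y⟩
    obtain ⟨i, hy⟩ := cs.exists_rightDescent_of_ne_one hy1
    obtain ⟨j, hy'⟩ := cs.exists_rightDescent_of_ne_one hy1'
    by_cases hij : i = j
    · subst hij
      exact key h1 h2 h3 h4 hy hy'
    -- For distinct descents the longest dihedral element serves as a bridge: it shares `i` with
    -- `y`, and the resulting bound has the descent `j`, shared with `y'`.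
    have dx := cs.wordProd_braidWord_isSuffix hij (h1.isRightDescent hy) (h3.isRightDescent hy')
    have dx' := cs.wordProd_braidWord_isSuffix hij (h2.isRightDescent hy) (h4.isRightDescent hy')
    have dj := cs.isRightDescent_wordProd_braidWord hij
    have di := cs.isRightDescent_wordProd_braidWord (Ne.symm hij)
    rw [← cs.wordProd_braidWord_eq] at di
    obtain ⟨u, a1, a2, a3, a4⟩ := key h1 h2 dx dx' hy di
    obtain ⟨v, b1, b2, b3, b4⟩ := key a1 a2 h3 h4 (a4.isRightDescent dj) hy'
    exact ⟨v, b1, b2, a3.trans b3, b4⟩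

theorem exists_isSuffix_inf [Finite W] (x x' : W) :
    ∃ z, cs.IsSuffix z x ∧ cs.IsSuffix z x' ∧
      ∀ y, cs.IsSuffix y x → cs.IsSuffix y x' → cs.IsSuffix y z := by
  obtain ⟨z, ⟨hz, hz'⟩, hmax⟩ := Set.exists_max_image {z | cs.IsSuffix z x ∧ cs.IsSuffix z x'}
    cs.length (Set.toFinite _) ⟨1, cs.one_isSuffix x, cs.one_isSuffix x'⟩
  refine ⟨z, hz, hz', fun y hy hy' ↦ ?_⟩
  obtain ⟨u, h1, h2, h3, h4⟩ := cs.exists_isSuffix_of_isSuffix hz hz' hy hy'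
  rwa [h3.eq_of_length_le (hmax u ⟨h1, h2⟩)]

/-! ### The longest element -/

/-- By maximality every simple reflection is a descent of the longest element, so it makes all
simple roots negative, hence all positive roots. -/
theorem isSuffix_longest [Finite W] (x : W) : cs.IsSuffix x cs.longest := by
  have hd : ∀ i, cs.IsRightDescent cs.longest i := by
    intro i
    by_contra h
    have h1 : cs.length (cs.longest * cs.simple i) ≤ cs.length cs.longest :=
      (Finite.exists_max cs.length).choose_spec _
    rw [cs.not_isRightDescent_iff.1 h] at h1
    omega
  rw [isSuffix_iff_invRoots_subset]
  rintro β ⟨h1, h2, -⟩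
  refine ⟨h1, h2, fun b ↦ ?_⟩
  have e : β = ∑ i ∈ β.support, β i • Finsupp.single i (1 : ℝ) := by
    conv_lhs => rw [← Finsupp.sum_single β]
    simp [Finsupp.sum]
  rw [e, map_sum, Finsupp.finsetSum_apply]
  refine Finset.sum_nonpos fun i _ ↦ ?_
  rw [map_smul, Finsupp.smul_apply, smul_eq_mul]
  exact mul_nonpos_of_nonneg_of_nonpos (h2 i) (cs.reflRep_single_nonpos _ i (hd i) b)

theorem length_longest_mul [Finite W] (x : W) :
    cs.length (cs.longest * x) + cs.length x = cs.length cs.longest := by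
  simpa [IsSuffix] using cs.isSuffix_longest x⁻¹

/-- It turns reducedness of a product into an order condition, so that the greatest suffix of `x`
with reduced product is the meet of `x` and `longest * v⁻¹`. -/
theorem isSuffix_longest_mul_inv_iff [Finite W] {y v : W} :
    cs.IsSuffix y (cs.longest * v⁻¹) ↔ cs.length (y * v) = cs.length y + cs.length v := by
  have e : cs.longest * v⁻¹ * y⁻¹ = cs.longest * (y * v)⁻¹ := by group
  have h1 := cs.length_longest_mul v⁻¹
  have h2 := cs.length_longest_mul (y * v)⁻¹
  rw [length_inv] at h1 h2
  rw [IsSuffix, e]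
  omega

/-! ### Right multiplication of normal forms -/

theorem exists_maxSuffix [Finite W] (x v : W) :
    ∃ z, cs.IsSuffix z x ∧ cs.length (z * v) = cs.length z + cs.length v ∧
      ∀ y, cs.IsSuffix y x → cs.length (y * v) = cs.length y + cs.length v →
        cs.IsSuffix y z := by
  obtain ⟨z, h1, h2, h3⟩ := cs.exists_isSuffix_inf x (cs.longest * v⁻¹)
  simp only [isSuffix_longest_mul_inv_iff] at h2 h3
  exact ⟨z, h1, h2, h3⟩

/-- The longest suffix `z` of `x` such that the product `z * v` is reduced. -/
noncomputable def maxSuffix [Finite W] (x v : W) : W := (cs.exists_maxSuffix x v).choose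

theorem isSuffix_mul_right_iff {x y v : W} (hx : cs.length (x * v) = cs.length x + cs.length v)
    (hy : cs.length (y * v) = cs.length y + cs.length v) :
    cs.IsSuffix (y * v) (x * v) ↔ cs.IsSuffix y x := by
  have e : x * v * (y * v)⁻¹ = x * y⁻¹ := by group
  unfold IsSuffix
  rw [e]
  omega

section MaxSuffix

variable [Finite W]

theorem maxSuffix_isSuffix (x v : W) : cs.IsSuffix (cs.maxSuffix x v) x :=
  (cs.exists_maxSuffix x v).choose_spec.1

theorem length_maxSuffix_mul (x v : W) :
    cs.length (cs.maxSuffix x v * v) = cs.length (cs.maxSuffix x v) + cs.length v :=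
  (cs.exists_maxSuffix x v).choose_spec.2.1

variable {cs} in
theorem IsSuffix.le_maxSuffix {x y v : W} (h : cs.IsSuffix y x)
    (h' : cs.length (y * v) = cs.length y + cs.length v) : cs.IsSuffix y (cs.maxSuffix x v) :=
  (cs.exists_maxSuffix x v).choose_spec.2.2 y h h'

theorem maxSuffix_one_right (x : W) : cs.maxSuffix x 1 = x := by
  refine (cs.maxSuffix_isSuffix x 1).eq_of_length_le ?_
  exact ((cs.isSuffix_refl x).le_maxSuffix (by simp)).length_le

theorem isSuffix_maxSuffix_mul (x v : W) : cs.IsSuffix v (cs.maxSuffix x v * v) :=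
  cs.isSuffix_mul_iff.2 (cs.length_maxSuffix_mul x v)

/-- Absorbing `v` and then `v'` must agree with absorbing `v * v'`; otherwise the action would not
respect the braid relations. -/
theorem maxSuffix_mul {x v v' : W} (h : cs.length (v * v') = cs.length v + cs.length v') :
    cs.maxSuffix (cs.maxSuffix x v * v) v' = cs.maxSuffix x (v * v') * v := by
  have h0 := cs.length_maxSuffix_mul x v
  have h1 := cs.length_maxSuffix_mul x (v * v')
  have h2 := cs.length_maxSuffix_mul (cs.maxSuffix x v * v) v'
  have hmax := fun y ↦ IsSuffix.le_maxSuffix (cs := cs) (x := x) (y := y) (v := v * v')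
  have hmax0 := fun y ↦ IsSuffix.le_maxSuffix (cs := cs) (x := x) (y := y) (v := v)
  have s0 := cs.maxSuffix_isSuffix x v
  have s1 := cs.maxSuffix_isSuffix x (v * v')
  have s2 := cs.maxSuffix_isSuffix (cs.maxSuffix x v * v) v'
  have hmax2 := fun y ↦
    IsSuffix.le_maxSuffix (cs := cs) (x := cs.maxSuffix x v * v) (y := y) (v := v')
  generalize cs.maxSuffix (cs.maxSuffix x v * v) v' = y₁ at *
  generalize cs.maxSuffix x v = y₀ at *
  generalize cs.maxSuffix x (v * v') = y at *
  rw [← mul_assoc] at h1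
  have l1 := cs.length_mul_le (y * v) v'
  have l2 := cs.length_mul_le y v
  have hyv : cs.length (y * v) = cs.length y + cs.length v := by omega
  -- Since `y * v` competes in the definition of `y₁`, the latter ends in `v`, say `y₁ = z * v`;
  -- conversely `z` competes in the definition of `y`, and lengths decide.
  have a1 : cs.IsSuffix (y * v) y₁ := by
    refine hmax2 _ ((cs.isSuffix_mul_right_iff h0 hyv).2 (hmax0 _ s1 hyv)) ?_
    omega
  have a2 : cs.IsSuffix v y₁ := (cs.isSuffix_mul_iff.2 hyv).trans a1
  obtain ⟨z, rfl⟩ : ∃ z, y₁ = z * v := ⟨y₁ * v⁻¹, by group⟩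
  rw [isSuffix_mul_iff] at a2
  have a3 : cs.IsSuffix z x := ((cs.isSuffix_mul_right_iff h0 a2).1 s2).trans s0
  have a4 : cs.IsSuffix z y := hmax _ a3 (by rw [← mul_assoc]; omega)
  have := a4.length_le
  exact (a1.eq_of_length_le (by omega)).symm

/-- Right multiplication by the reduced braid of `v` on pairs consisting of a braid and a head. -/
noncomputable def garsideStep (v : W) (p : M.BraidMonoid × W) : M.BraidMonoid × W :=
  (p.1 * cs.reducedBraid (p.2 * (cs.maxSuffix p.2 v)⁻¹), cs.maxSuffix p.2 v * v)

theorem garsideStep_one (p : M.BraidMonoid × W) : cs.garsideStep 1 p = p := by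
  simp [garsideStep, maxSuffix_one_right, reducedBraid_one]

theorem reducedBraid_eq_of_isSuffix {x y : W} (h : cs.IsSuffix y x) :
    cs.reducedBraid x = cs.reducedBraid (x * y⁻¹) * cs.reducedBraid y := by
  rw [← cs.reducedBraid_mul, inv_mul_cancel_right]
  rw [inv_mul_cancel_right]
  exact h.symm

/-- The heads agree by `maxSuffix_mul`. The two pieces pushed into the remainder come from a chain
of suffixes of the head, so their lengths add up and their reduced braids multiply. -/
theorem garsideStep_mul {v v' : W} (h : cs.length (v * v') = cs.length v + cs.length v')
    (p : M.BraidMonoid × W) :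
    cs.garsideStep v' (cs.garsideStep v p) = cs.garsideStep (v * v') p := by
  unfold garsideStep
  simp only
  rw [cs.maxSuffix_mul h, mul_assoc _ v v', mul_assoc p.1]
  congr 2
  have hv := cs.length_maxSuffix_mul p.2 (v * v')
  rw [← mul_assoc] at hv
  have l1 := cs.length_mul_le (cs.maxSuffix p.2 (v * v') * v) v'
  have l2 := cs.length_mul_le (cs.maxSuffix p.2 (v * v')) v
  have hs : cs.IsSuffix (cs.maxSuffix p.2 (v * v')) (cs.maxSuffix p.2 v) :=
    (cs.maxSuffix_isSuffix p.2 (v * v')).le_maxSuffix (by omega)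
  have hs' := cs.maxSuffix_isSuffix p.2 (v * v')
  have hs'' := cs.maxSuffix_isSuffix p.2 v
  have e1 : cs.maxSuffix p.2 v * v * (cs.maxSuffix p.2 (v * v') * v)⁻¹ =
    cs.maxSuffix p.2 v * (cs.maxSuffix p.2 (v * v'))⁻¹ := by group
  have e2 : p.2 * (cs.maxSuffix p.2 (v * v'))⁻¹ = (p.2 * (cs.maxSuffix p.2 v)⁻¹) *
    (cs.maxSuffix p.2 v * (cs.maxSuffix p.2 (v * v'))⁻¹) := by group
  have hlen : cs.length (p.2 * (cs.maxSuffix p.2 v)⁻¹ *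
      (cs.maxSuffix p.2 v * (cs.maxSuffix p.2 (v * v'))⁻¹)) =
      cs.length (p.2 * (cs.maxSuffix p.2 v)⁻¹) +
        cs.length (cs.maxSuffix p.2 v * (cs.maxSuffix p.2 (v * v'))⁻¹) := by
    rw [← e2]
    unfold IsSuffix at hs hs' hs''
    omega
  rw [e1, e2, cs.reducedBraid_mul hlen]

theorem foldl_garsideStep {l : List B} (hl : cs.IsReduced l) (p : M.BraidMonoid × W) :
    l.foldl (fun p i ↦ cs.garsideStep (cs.simple i) p) p = cs.garsideStep (cs.wordProd l) p := by
  induction l using List.reverseRecOn with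
  | nil => simp [garsideStep_one]
  | append_singleton l i ih =>
    obtain ⟨h1, -, h2⟩ := hl.of_append
    rw [List.foldl_append, ih h1, List.foldl_cons, List.foldl_nil, wordProd_append,
      wordProd_singleton, garsideStep_mul]
    rwa [wordProd_singleton] at h2

/-- Right multiplication by a generator, as an element of a monoid. -/
noncomputable def garsideGen (i : B) : (Function.End (M.BraidMonoid × W))ᵐᵒᵖ :=
  MulOpposite.op (cs.garsideStep (cs.simple i))

theorem lift_garsideGen (l : List B) (p : M.BraidMonoid × W) :
    (FreeMonoid.lift cs.garsideGen (FreeMonoid.ofList l)).unop p =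
    l.foldl (fun p i ↦ cs.garsideStep (cs.simple i) p) p := by
  induction l generalizing p with
  | nil => rw [FreeMonoid.ofList_nil, map_one]; rfl
  | cons i l ih =>
    rw [FreeMonoid.ofList_cons, map_mul, MulOpposite.unop_mul, List.foldl_cons, ← ih,
      FreeMonoid.lift_eval_of]
    rfl

/-- The right action of the braid monoid on pairs consisting of a braid and a head. -/
noncomputable def garsideAction :
    M.BraidMonoid →* (Function.End (M.BraidMonoid × W))ᵐᵒᵖ :=
  PresentedMonoid.lift (rels := M.braidRel) cs.garsideGen (by
    rintro a b ⟨i, j, -, rfl, rfl⟩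
    by_cases hij : i = j
    · rw [hij]
    apply MulOpposite.unop_injective
    funext p
    -- Both sides of a braid relation are reduced words of one element, and a reduced word acts
    -- through its element.
    rw [lift_garsideGen, lift_garsideGen, cs.foldl_garsideStep (cs.isReduced_braidWord hij),
      cs.foldl_garsideStep (cs.isReduced_braidWord (Ne.symm hij)), cs.wordProd_braidWord_eq])

theorem garsideAction_reducedBraid (v : W) (p : M.BraidMonoid × W) :
    (cs.garsideAction (cs.reducedBraid v)).unop p = cs.garsideStep v p := by
  obtain ⟨l, hl, rfl⟩ := cs.exists_isReduced v
  rw [cs.reducedBraid_wordProd hl, ← cs.foldl_garsideStep hl, ← lift_garsideGen]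
  rfl

/-! ### Heads, remainders and greatest common divisors. -/

/-- A braid after removal of its head, together with its head. -/
noncomputable def garsideState (b : M.BraidMonoid) : M.BraidMonoid × W :=
  (cs.garsideAction b).unop (1, 1)

theorem garsideState_one : cs.garsideState 1 = (1, 1) := by
  rw [garsideState, map_one]
  rfl

theorem garsideState_mul_reducedBraid (b : M.BraidMonoid) (v : W) :
    cs.garsideState (b * cs.reducedBraid v) = cs.garsideStep v (cs.garsideState b) := by
  rw [garsideState, map_mul, MulOpposite.unop_mul, ← garsideAction_reducedBraid]
  rfl

/-- The element of the Coxeter group whose reduced braid is the head of `b`. -/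
noncomputable def garsideHead (b : M.BraidMonoid) : W := (cs.garsideState b).2

/-- The braid `b` after removal of its head. -/
noncomputable def garsideRest (b : M.BraidMonoid) : M.BraidMonoid := (cs.garsideState b).1

theorem garsideHead_mul_reducedBraid (b : M.BraidMonoid) (v : W) :
    cs.garsideHead (b * cs.reducedBraid v) = cs.maxSuffix (cs.garsideHead b) v * v := by
  rw [garsideHead, garsideState_mul_reducedBraid]
  rfl

theorem garsideRest_mul_reducedBraid (b : M.BraidMonoid) (v : W) :
    cs.garsideRest (b * cs.reducedBraid v) = cs.garsideRest b *
      cs.reducedBraid (cs.garsideHead b * (cs.maxSuffix (cs.garsideHead b) v)⁻¹) := by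
  rw [garsideRest, garsideState_mul_reducedBraid]
  rfl

end MaxSuffix

theorem braid_induction {P : M.BraidMonoid → Prop} (h1 : P 1)
    (hmul : ∀ b i, P b → P (b * PresentedMonoid.of M.braidRel i)) (b : M.BraidMonoid) : P b := by
  obtain ⟨l, rfl⟩ := PresentedMonoid.surjective_mk b
  change P (braidOfWord l.toList)
  induction l.toList using List.reverseRecOn with
  | nil => exact h1
  | append_singleton l i ih =>
    rw [braidOfWord_append]
    exact hmul _ _ ih

/-- The length of a positive braid. -/
def braidLength : M.BraidMonoid →* Multiplicative ℕ :=
  PresentedMonoid.lift (rels := M.braidRel) (fun _ ↦ Multiplicative.ofAdd 1) (by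
    rintro _ _ ⟨i, j, -, rfl, rfl⟩
    simp [FreeMonoid.lift_apply, M.symmetric j i])

theorem braidLength_braidOfWord (l : List B) :
    braidLength (braidOfWord l : M.BraidMonoid) = Multiplicative.ofAdd l.length := by
  change FreeMonoid.lift _ (FreeMonoid.ofList l) = _
  rw [FreeMonoid.lift_apply]
  simp [← ofAdd_nsmul]

theorem braidLength_reducedBraid (x : W) :
    braidLength (cs.reducedBraid x) = Multiplicative.ofAdd (cs.length x) := by
  have h := (cs.exists_isReduced x).choose_spec
  rw [reducedBraid, braidLength_braidOfWord, ← h.1.eq, ← h.2]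

section Garside

variable [Finite W]

theorem garsideRest_mul_garsideHead (b : M.BraidMonoid) :
    cs.garsideRest b * cs.reducedBraid (cs.garsideHead b) = b := by
  induction b using braid_induction with
  | h1 => simp [garsideRest, garsideHead, garsideState_one, reducedBraid_one]
  | hmul b i ih =>
    rw [← cs.reducedBraid_simple, garsideHead_mul_reducedBraid, garsideRest_mul_reducedBraid,
      cs.reducedBraid_mul (cs.length_maxSuffix_mul _ _), mul_assoc, ← mul_assoc (cs.reducedBraid _),
      ← cs.reducedBraid_eq_of_isSuffix (cs.maxSuffix_isSuffix _ _), ← mul_assoc, ih]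

/-- The head of `a * b_y` ends in `y` by construction; conversely, factor the head. -/
theorem reducedBraid_isRightDivisor_iff {y : W} {b : M.BraidMonoid} :
    IsRightDivisor (cs.reducedBraid y) b ↔ cs.IsSuffix y (cs.garsideHead b) := by
  constructor
  · rintro ⟨a, rfl⟩
    rw [garsideHead_mul_reducedBraid]
    exact cs.isSuffix_maxSuffix_mul _ _
  · intro h
    refine ⟨cs.garsideRest b * cs.reducedBraid (cs.garsideHead b * y⁻¹), ?_⟩
    rw [mul_assoc, ← cs.reducedBraid_eq_of_isSuffix h, garsideRest_mul_garsideHead]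

theorem maxSuffix_one_left (v : W) : cs.maxSuffix 1 v = 1 := by
  rw [← cs.length_eq_zero_iff]
  have := (cs.maxSuffix_isSuffix 1 v).length_le
  simpa using this

theorem garsideHead_reducedBraid (v : W) : cs.garsideHead (cs.reducedBraid v) = v := by
  rw [← one_mul (cs.reducedBraid v), garsideHead_mul_reducedBraid, garsideHead, garsideState_one,
    maxSuffix_one_left, one_mul]

/-- Remainders are unique, without appeal to cancellation in the braid monoid. Comparing heads shows
that no part of the head of `c` is absorbed, so the action leaves all of `c` as the remainder. -/
theorem eq_garsideRest {b c : M.BraidMonoid}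
    (h : b = c * cs.reducedBraid (cs.garsideHead b)) : c = cs.garsideRest b := by
  have h1 := congrArg cs.garsideHead h
  rw [garsideHead_mul_reducedBraid, right_eq_mul] at h1
  conv_rhs => rw [h]
  rw [garsideRest_mul_reducedBraid, h1, inv_one, mul_one, garsideRest_mul_garsideHead]

/-- Length and image in the group are invariants of a braid. So a word for the product has the
length of its element, which makes it reduced, and its tail as well. -/
theorem eq_reducedBraid_of_isRightDivisor {c : M.BraidMonoid} {x : W}
    (h : IsRightDivisor c (cs.reducedBraid x)) : c = cs.reducedBraid (cs.ofBraid c) := by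
  obtain ⟨a, ha⟩ := h
  obtain ⟨k, hk⟩ := PresentedMonoid.surjective_mk a
  obtain ⟨l, hl⟩ := PresentedMonoid.surjective_mk c
  obtain ⟨r, hr, rfl⟩ := cs.exists_isReduced x
  have hk : a = braidOfWord k.toList := hk.symm
  have hl : c = braidOfWord l.toList := hl.symm
  rw [cs.reducedBraid_wordProd hr, hk, hl, ← braidOfWord_append] at ha
  have e1 := congrArg cs.ofBraid ha
  have e2 := congrArg braidLength ha
  rw [ofBraid_braidOfWord, ofBraid_braidOfWord] at e1
  rw [braidLength_braidOfWord, braidLength_braidOfWord, Multiplicative.ofAdd.injective.eq_iff] at e2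
  have hred : cs.IsReduced (k.toList ++ l.toList) := by
    rw [IsReduced, ← e1, hr.eq, e2]
  rw [hl, ofBraid_braidOfWord, cs.reducedBraid_wordProd hred.of_append.2.1]

theorem isRightGCD_garsideHead (b : M.BraidMonoid) :
    IsRightGCD (cs.reducedBraid (cs.garsideHead b)) b (cs.reducedBraid cs.longest) := by
  refine ⟨cs.reducedBraid_isRightDivisor_iff.2 (cs.isSuffix_refl _), ?_, fun c hb hc ↦ ?_⟩
  · rw [reducedBraid_isRightDivisor_iff, garsideHead_reducedBraid]
    exact cs.isSuffix_longest _
  · rw [cs.eq_reducedBraid_of_isRightDivisor hc] at hb ⊢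
    rw [reducedBraid_isRightDivisor_iff] at hb ⊢
    rwa [garsideHead_reducedBraid]

/-- Both greatest common divisors are reduced braids, and mutual divisibility becomes antisymmetry
of the suffix order. Thus the choice in `head` is harmless. -/
theorem eq_garsideHead_of_isRightGCD {b g : M.BraidMonoid}
    (h : IsRightGCD g b (cs.reducedBraid cs.longest)) :
    g = cs.reducedBraid (cs.garsideHead b) := by
  obtain ⟨h1, h2, h3⟩ := h
  have e := cs.isRightGCD_garsideHead b
  have h3 := h3 _ e.1 e.2.1
  rw [cs.eq_reducedBraid_of_isRightDivisor h2] at h1 h3 ⊢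
  rw [reducedBraid_isRightDivisor_iff] at h1 h3
  rw [garsideHead_reducedBraid] at h3
  rw [h1.eq_of_length_le h3.length_le]

end Garside

end CoxeterSystem

/-! ### Computation of the chosen heads and remainders. -/

namespace TwistedCoxeterSystem

variable {B : Type*} {M : CoxeterMatrix B} {W Ω : Type*} [Group W] [Group Ω]
  (T : TwistedCoxeterSystem M W Ω) [Finite W]

theorem head_eq (b : M.BraidMonoid) : T.head b = T.cs.reducedBraid (T.cs.garsideHead b) := by
  have h : ∃ g, IsRightGCD g b (T.cs.reducedBraid T.cs.longest) :=
    ⟨_, T.cs.isRightGCD_garsideHead b⟩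
  rw [head, dif_pos h]
  exact T.cs.eq_garsideHead_of_isRightGCD h.choose_spec

theorem remainder_eq (b : M.BraidMonoid) : T.remainder b = T.cs.garsideRest b := by
  have h : ∃ c, b = c * T.head b :=
    ⟨T.cs.garsideRest b, by rw [head_eq, T.cs.garsideRest_mul_garsideHead]⟩
  rw [remainder, dif_pos h]
  exact T.cs.eq_garsideRest (h.choose_spec.trans (congrArg (h.choose * ·) (T.head_eq b)))

end TwistedCoxeterSystem

namespace CoxeterSystem

open CoxeterMatrix

variable {B : Type*} {M : CoxeterMatrix B} {W : Type*} [Group W] (cs : CoxeterSystem M W)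

/-! ### Root inversion sets of braids -/

theorem mem_rootInvSeq_append {l k : List B} {β : B →₀ ℝ} : β ∈ cs.rootInvSeq (l ++ k) ↔
    cs.reflRep (cs.wordProd k) β ∈ cs.rootInvSeq l ∨ β ∈ cs.rootInvSeq k := by
  rw [rootInvSeq_append, List.mem_append, List.mem_map]
  refine or_congr_left ⟨?_, fun h ↦ ⟨_, h, cs.reflRep_inv_reflRep _ _⟩⟩
  rintro ⟨γ, h, rfl⟩
  rwa [reflRep_reflRep_inv]

/-- The root inversion set of a braid. -/
def braidRoots (b : M.BraidMonoid) : Set (B →₀ ℝ) :=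
  {β | ∃ l : List B, b = braidOfWord l ∧ β ∈ cs.rootInvSeq l}

/-- Words with the same element and the same root inversion set. -/
def rootInvCon : Con (FreeMonoid B) where
  r a b := cs.wordProd a.toList = cs.wordProd b.toList ∧
    ∀ β, β ∈ cs.rootInvSeq a.toList ↔ β ∈ cs.rootInvSeq b.toList
  iseqv :=
    { refl := fun _ ↦ ⟨rfl, fun _ ↦ Iff.rfl⟩
      symm := fun h ↦ ⟨h.1.symm, fun β ↦ (h.2 β).symm⟩
      trans := fun h h' ↦ ⟨h.1.trans h'.1, fun β ↦ (h.2 β).trans (h'.2 β)⟩ }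
  mul' h h' := by
    rw [FreeMonoid.toList_mul, FreeMonoid.toList_mul]
    refine ⟨by rw [wordProd_append, wordProd_append, h.1, h'.1], fun β ↦ ?_⟩
    rw [mem_rootInvSeq_append, mem_rootInvSeq_append, h'.1, h.2, h'.2]

theorem isRoot_of_mem_braidRoots {b : M.BraidMonoid} {β : B →₀ ℝ} (h : β ∈ cs.braidRoots b) :
    cs.IsRoot β := by
  obtain ⟨l, -, hl⟩ := h
  exact cs.isRoot_of_mem_rootInvSeq hl

variable [Finite W]

theorem mem_braidRoots_braidOfWord {l : List B} {β : B →₀ ℝ} :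
    β ∈ cs.braidRoots (braidOfWord l) ↔ β ∈ cs.rootInvSeq l := by
  refine ⟨?_, fun h ↦ ⟨l, rfl, h⟩⟩
  rintro ⟨k, h, hβ⟩
  -- The two sides of a braid relation are reduced words of the same element, so both list its
  -- inversion set.
  have hle : conGen M.braidRel ≤ cs.rootInvCon := by
    rw [Con.conGen_le]
    rintro _ _ ⟨i, j, -, rfl, rfl⟩
    by_cases hij : i = j
    · subst hij
      exact cs.rootInvCon.refl _
    · refine ⟨cs.wordProd_braidWord_eq i j, fun β ↦ ?_⟩
      rw [FreeMonoid.toList_ofList, FreeMonoid.toList_ofList,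
        (cs.isReduced_braidWord hij).mem_rootInvSeq_iff,
        (cs.isReduced_braidWord (Ne.symm hij)).mem_rootInvSeq_iff, cs.wordProd_braidWord_eq]
  exact ((hle (PresentedMonoid.mk_eq_mk_iff.1 h)).2 β).2 hβ

theorem mem_braidRoots_mul {a b : M.BraidMonoid} {β : B →₀ ℝ} :
    β ∈ cs.braidRoots (a * b) ↔
      cs.reflRep (cs.ofBraid b) β ∈ cs.braidRoots a ∨ β ∈ cs.braidRoots b := by
  obtain ⟨k, hk⟩ := PresentedMonoid.surjective_mk a
  obtain ⟨l, hl⟩ := PresentedMonoid.surjective_mk b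
  have hk : a = braidOfWord k.toList := hk.symm
  have hl : b = braidOfWord l.toList := hl.symm
  rw [hk, hl, ← braidOfWord_append]
  simp only [mem_braidRoots_braidOfWord]
  rw [mem_rootInvSeq_append, ofBraid_braidOfWord]

theorem braidRoots_one : cs.braidRoots 1 = ∅ := by
  ext β
  refine iff_of_false (fun h ↦ ?_) (Set.notMem_empty β)
  exact List.not_mem_nil ((cs.mem_braidRoots_braidOfWord (l := [])).1 h)

theorem braidRoots_reducedBraid (x : W) : cs.braidRoots (cs.reducedBraid x) = cs.invRoots x := by
  obtain ⟨l, hl, rfl⟩ := cs.exists_isReduced x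
  ext β
  rw [cs.reducedBraid_wordProd hl, mem_braidRoots_braidOfWord, hl.mem_rootInvSeq_iff]

/-! ### Iterated remainders -/

/-- The element that is pushed past the first `n` Garside factors `f 0, …, f (n - 1)` when a braid
is multiplied by the reduced braid of `v` on the right. -/
noncomputable def garsideCarry (f : ℕ → W) (v : W) : ℕ → W
  | 0 => v
  | n + 1 => f n * (cs.maxSuffix (f n) (garsideCarry f v n))⁻¹

theorem garsideCarry_congr {f g : ℕ → W} {v : W} {n : ℕ} (h : ∀ j < n, f j = g j) :
    cs.garsideCarry f v n = cs.garsideCarry g v n := by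
  induction n with
  | zero => rfl
  | succ n ih =>
    rw [garsideCarry, garsideCarry, ih fun j hj ↦ h j (by omega), h n (by omega)]

/-- The element carried past the first `n` factors depends on `b` only through these factors. This
makes the recursion for the next factor autonomous once they are stable. -/
theorem iterate_garsideRest_mul_reducedBraid (b : M.BraidMonoid) (v : W) (n : ℕ) :
    cs.garsideRest^[n] (b * cs.reducedBraid v) = cs.garsideRest^[n] b *
      cs.reducedBraid (cs.garsideCarry (fun j ↦ cs.garsideHead (cs.garsideRest^[j] b)) v n) := by
  induction n with
  | zero => rfl
  | succ n ih =>
    rw [Function.iterate_succ_apply', ih, garsideRest_mul_reducedBraid,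
      Function.iterate_succ_apply']
    rfl

/-- As long as the heads of `a * b` and `b` agree, the same braids are removed on the right, and `a`
stays in front by uniqueness of remainders. -/
theorem iterate_garsideRest_mul_of_garsideHead_eq {a b : M.BraidMonoid} {n : ℕ}
    (h : ∀ j < n, cs.garsideHead (cs.garsideRest^[j] (a * b)) =
      cs.garsideHead (cs.garsideRest^[j] b)) :
    cs.garsideRest^[n] (a * b) = a * cs.garsideRest^[n] b := by
  induction n with
  | zero => rfl
  | succ n ih =>
    have ih := ih fun j hj ↦ h j (by omega)
    rw [Function.iterate_succ_apply', Function.iterate_succ_apply']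
    symm
    apply cs.eq_garsideRest
    rw [h n (by omega), ih, mul_assoc, garsideRest_mul_garsideHead]

end CoxeterSystem

namespace TwistedCoxeterSystem

open CoxeterMatrix CoxeterSystem

variable {B : Type*} {M : CoxeterMatrix B} {W Ω : Type*} [Group W] [Group Ω]
  (T : TwistedCoxeterSystem M W Ω)

/-! ### Twists -/

theorem φ_wordProd (δ : Ω) (l : List B) :
    T.φ δ (T.cs.wordProd l) = T.cs.wordProd (l.map (T.simplePerm δ)) := by
  induction l with
  | nil => simp
  | cons i l ih => rw [List.map_cons, wordProd_cons, wordProd_cons, map_mul, ih, φ_simple]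

theorem length_φ (δ : Ω) (x : W) : T.cs.length (T.φ δ x) = T.cs.length x := by
  have h : ∀ (δ : Ω) (x : W), T.cs.length (T.φ δ x) ≤ T.cs.length x := by
    intro δ x
    obtain ⟨l, hl, rfl⟩ := T.cs.exists_isReduced x
    rw [φ_wordProd, hl.eq]
    simpa using T.cs.length_wordProd_le (l.map (T.simplePerm δ))
  refine le_antisymm (h δ x) ?_
  have := h δ⁻¹ (T.φ δ x)
  rwa [← MulAut.mul_apply, ← map_mul, inv_mul_cancel, map_one, MulAut.one_apply] at this

theorem twistBraid_braidOfWord (δ : Ω) (l : List B) :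
    T.twistBraid δ (braidOfWord l) = braidOfWord (l.map (T.simplePerm δ)) := by
  induction l with
  | nil => exact map_one _
  | cons i l ih =>
    rw [← List.singleton_append, braidOfWord_append, map_mul, ih, List.map_append,
      braidOfWord_append]
    rfl

theorem braidLength_twistBraid (δ : Ω) (b : M.BraidMonoid) :
    braidLength (T.twistBraid δ b) = braidLength b := by
  obtain ⟨l, hl⟩ := PresentedMonoid.surjective_mk b
  have hl : b = braidOfWord l.toList := hl.symm
  rw [hl, twistBraid_braidOfWord, braidLength_braidOfWord, braidLength_braidOfWord,
    List.length_map]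

theorem twistRep_apply_simplePerm (δ : Ω) (v : B →₀ ℝ) (b : B) :
    T.twistRep δ v (T.simplePerm δ b) = v b := by
  simp [twistRep, Finsupp.domLCongr_apply]

theorem twistRep_nonpos_iff (δ : Ω) (v : B →₀ ℝ) :
    (∀ b, T.twistRep δ v b ≤ 0) ↔ ∀ b, v b ≤ 0 := by
  rw [← (T.simplePerm δ).forall_congr_right]
  simp only [twistRep_apply_simplePerm]

theorem rep_inl (x : W) (v : B →₀ ℝ) :
    T.rep (SemidirectProduct.inl x) v = T.cs.reflRep x v := by
  rw [rep, SemidirectProduct.lift_inl]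

theorem rep_inr (δ : Ω) (v : B →₀ ℝ) :
    T.rep (SemidirectProduct.inr δ) v = T.twistRep δ v := by
  rw [rep, SemidirectProduct.lift_inr]

theorem rep_mul_apply (w w' : T.Grp) (v : B →₀ ℝ) : T.rep (w * w') v = T.rep w (T.rep w' v) := by
  rw [map_mul, LinearEquiv.mul_apply]

theorem rep_apply (w : T.Grp) (v : B →₀ ℝ) :
    T.rep w v = T.twistRep w.right (T.cs.reflRep (T.untwisted w) v) := by
  conv_lhs => rw [← T.inr_mul_inl_untwisted w]
  rw [rep_mul_apply, rep_inl, rep_inr]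

theorem twistRep_reflRep (δ : Ω) (x : W) (v : B →₀ ℝ) :
    T.twistRep δ (T.cs.reflRep x v) = T.cs.reflRep (T.φ δ x) (T.twistRep δ v) := by
  have h : (SemidirectProduct.inr δ * SemidirectProduct.inl x : T.Grp) =
      SemidirectProduct.inl (T.φ δ x) * SemidirectProduct.inr δ := by
    ext <;> simp
  rw [← rep_inl, ← rep_inr, ← rep_mul_apply, h, rep_mul_apply, rep_inl, rep_inr]

theorem isRoot_twistRep {β : B →₀ ℝ} (h : T.cs.IsRoot β) (δ : Ω) :
    T.cs.IsRoot (T.twistRep δ β) := by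
  obtain ⟨x, i, rfl⟩ := h
  exact ⟨T.φ δ x, T.simplePerm δ i, by rw [twistRep_reflRep, twistRep_single]⟩

theorem isRoot_rep {β : B →₀ ℝ} (h : T.cs.IsRoot β) (w : T.Grp) : T.cs.IsRoot (T.rep w β) := by
  rw [rep_apply]
  exact T.isRoot_twistRep (h.reflRep _) _

/-- A twist permutes the simple roots, so it does not affect signs. -/
theorem invSet_eq (w : T.Grp) : T.invSet w = T.cs.invRoots (T.untwisted w) := by
  ext β
  constructor
  · rintro ⟨⟨h1, h2⟩, -, h3⟩
    rw [rep_apply, twistRep_nonpos_iff] at h3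
    exact ⟨h1, h2, h3⟩
  · rintro ⟨h1, h2, h3⟩
    refine ⟨⟨h1, h2⟩, T.isRoot_rep h1 w, ?_⟩
    rwa [rep_apply, twistRep_nonpos_iff]

theorem untwisted_inl (x : W) : T.untwisted (SemidirectProduct.inl x) = x := by
  simp [untwisted]

theorem invSet_ofBraid_reducedBraid (x : W) :
    T.invSet (T.ofBraid (T.cs.reducedBraid x)) = T.cs.invRoots x := by
  rw [invSet_eq, ofBraid, untwisted_inl, ofBraid_reducedBraid]

theorem rootInvSeq_map_simplePerm (δ : Ω) (l : List B) :
    T.cs.rootInvSeq (l.map (T.simplePerm δ)) = (T.cs.rootInvSeq l).map (T.twistRep δ) := by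
  induction l with
  | nil => rfl
  | cons i l ih =>
    rw [List.map_cons, rootInvSeq, rootInvSeq, ih, List.map_cons, ← φ_wordProd, ← map_inv,
      ← twistRep_single, twistRep_reflRep]

theorem mem_braidInvSet_iff {b : T.Br} {β : B →₀ ℝ} :
    β ∈ T.braidInvSet b ↔ β ∈ T.cs.braidRoots b.braid := by
  constructor
  · rintro ⟨δ, l, rfl, h⟩
    exact ⟨l, rfl, h⟩
  · rintro ⟨l, h, hβ⟩
    exact ⟨b.twist, l, Br.ext rfl h, hβ⟩

/-! ### Powers of a reduced braid -/

theorem braid_pow_succ (b : T.Br) (d : ℕ) :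
    (b ^ (d + 1)).braid = T.twistBraid b.twist⁻¹ (b ^ d).braid * b.braid := by
  rw [pow_succ]
  rfl

/-- The extra factor is put on the left here and on the right in `braid_pow_succ`; monotonicity
needs the former, the recursion the latter. The twist may remain unspecified. -/
theorem exists_braid_pow_succ (b : T.Br) (d : ℕ) :
    ∃ δ : Ω, (b ^ (d + 1)).braid = T.twistBraid δ b.braid * (b ^ d).braid := by
  rw [pow_succ']
  exact ⟨_, rfl⟩

/-- The exponent `1` excludes a positive orbit and the exponent `0` a negative one. -/
theorem notMem_stableRoots_of_mem_invSet {w : T.Grp} {β : B →₀ ℝ} (h : β ∈ T.invSet w) :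
    β ∉ T.stableRoots w := by
  rintro ⟨h1, h2 | h2⟩
  · have := h2 1
    rw [zpow_one] at this
    exact (T.isRoot_rep h1 w).not_nonneg_and_nonpos this.2 h.2.2
  · have := h2 0
    rw [zpow_zero, map_one] at this
    exact (show T.cs.IsRoot β from h1).not_nonneg_and_nonpos h.1.2 this.2

theorem rep_mem_stableRoots {w : T.Grp} {β : B →₀ ℝ} (h : β ∈ T.stableRoots w) :
    T.rep w β ∈ T.stableRoots w := by
  obtain ⟨h1, h2⟩ := h
  refine ⟨T.isRoot_rep h1 w, ?_⟩
  have e : ∀ k : ℤ, T.rep (w ^ k) (T.rep w β) = T.rep (w ^ (k + 1)) β := by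
    intro k
    rw [zpow_add_one, rep_mul_apply]
  simp only [e]
  exact h2.imp (fun h k ↦ h _) (fun h k ↦ h _)

theorem neg_mem_stableRoots {w : T.Grp} {β : B →₀ ℝ} (h : β ∈ T.stableRoots w) :
    -β ∈ T.stableRoots w := by
  obtain ⟨h1, h2⟩ := h
  have hr : T.cs.IsRoot β := h1
  refine ⟨hr.neg, h2.symm.imp (fun h k ↦ ?_) (fun h k ↦ ?_)⟩
  · rw [map_neg]
    exact ⟨(T.isRoot_rep hr _).neg, fun b ↦ by simpa using (h k).2 b⟩
  · rw [map_neg]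
    exact ⟨(T.isRoot_rep hr _).neg, fun b ↦ by simpa using (h k).2 b⟩

section Finite

variable [Finite W]

theorem len_eq (w : T.Grp) : T.len w = T.cs.length (T.untwisted w) := by
  rw [len, invSet_eq, (T.cs.invRoots_finite_and_ncard _).2]

theorem twistBraid_reducedBraid (δ : Ω) (x : W) :
    T.twistBraid δ (T.cs.reducedBraid x) = T.cs.reducedBraid (T.φ δ x) := by
  obtain ⟨l, hl, rfl⟩ := T.cs.exists_isReduced x
  have hr : T.cs.IsReduced (l.map (T.simplePerm δ)) := by
    rw [CoxeterSystem.IsReduced, ← φ_wordProd, length_φ, hl.eq, List.length_map]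
  rw [T.cs.reducedBraid_wordProd hl, φ_wordProd, T.cs.reducedBraid_wordProd hr,
    twistBraid_braidOfWord]

theorem garsideHead_twistBraid (δ : Ω) (b : M.BraidMonoid) :
    T.cs.garsideHead (T.twistBraid δ b) = T.φ δ (T.cs.garsideHead b) := by
  have h : ∀ (δ : Ω) (b : M.BraidMonoid),
      T.cs.IsSuffix (T.φ δ (T.cs.garsideHead b)) (T.cs.garsideHead (T.twistBraid δ b)) := by
    intro δ b
    rw [← reducedBraid_isRightDivisor_iff, ← twistBraid_reducedBraid]
    refine ⟨T.twistBraid δ (T.cs.garsideRest b), ?_⟩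
    rw [← map_mul, garsideRest_mul_garsideHead]
  refine ((h δ b).eq_of_length_le ?_).symm
  have := (h δ⁻¹ (T.twistBraid δ b)).length_le
  rwa [← twistBraid_mul, inv_mul_cancel, twistBraid_one, length_φ,
    ← T.length_φ δ (T.cs.garsideHead b)] at this

theorem garsideRest_twistBraid (δ : Ω) (b : M.BraidMonoid) :
    T.cs.garsideRest (T.twistBraid δ b) = T.twistBraid δ (T.cs.garsideRest b) := by
  symm
  apply T.cs.eq_garsideRest
  rw [garsideHead_twistBraid, ← twistBraid_reducedBraid, ← map_mul, garsideRest_mul_garsideHead]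

theorem iterate_garsideRest_twistBraid (δ : Ω) (b : M.BraidMonoid) (n : ℕ) :
    T.cs.garsideRest^[n] (T.twistBraid δ b) = T.twistBraid δ (T.cs.garsideRest^[n] b) :=
  ((show Function.Commute T.cs.garsideRest (T.twistBraid δ) from
    T.garsideRest_twistBraid δ).iterate_left n) b

theorem mem_braidRoots_of_twistBraid {δ : Ω} {b : M.BraidMonoid} {β : B →₀ ℝ}
    (h : β ∈ T.cs.braidRoots (T.twistBraid δ⁻¹ b)) : T.twistRep δ β ∈ T.cs.braidRoots b := by
  obtain ⟨l, hl⟩ := PresentedMonoid.surjective_mk b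
  have hl : b = braidOfWord l.toList := hl.symm
  rw [hl, twistBraid_braidOfWord, mem_braidRoots_braidOfWord, rootInvSeq_map_simplePerm,
    List.mem_map] at h
  obtain ⟨γ, h, rfl⟩ := h
  rw [hl, mem_braidRoots_braidOfWord, ← LinearEquiv.mul_apply, ← map_mul, mul_inv_cancel, map_one]
  exact h

/-- A root of the next power is either an inversion of `w` or is moved by `w` to a root of the
previous power, and `w` preserves stability. -/
theorem notMem_stableRoots_of_mem_braidRoots {w : T.Grp} {d : ℕ} {β : B →₀ ℝ}
    (h : β ∈ T.cs.braidRoots (T.reducedBraid w ^ d).braid) : β ∉ T.stableRoots w := by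
  induction d generalizing β with
  | zero =>
    rw [pow_zero] at h
    have h : β ∈ T.cs.braidRoots 1 := h
    rw [braidRoots_one] at h
    exact h.elim
  | succ d ih =>
    rw [braid_pow_succ] at h
    change β ∈ T.cs.braidRoots (_ * T.cs.reducedBraid (T.untwisted w)) at h
    rw [mem_braidRoots_mul, ofBraid_reducedBraid, braidRoots_reducedBraid, ← invSet_eq] at h
    rcases h with h | h
    · have := ih (T.mem_braidRoots_of_twistBraid h)
      change T.twistRep w.right _ ∉ _ at this
      rw [← rep_apply] at this
      exact fun hs ↦ this (T.rep_mem_stableRoots hs)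
    · exact T.notMem_stableRoots_of_mem_invSet h

theorem posRoots_finite : T.posRoots.Finite := by
  have := T.cs.finite_index
  refine (Set.finite_range fun p : W × B ↦
    T.cs.reflRep p.1 (Finsupp.single p.2 1)).subset ?_
  rintro _ ⟨⟨x, i, rfl⟩, -⟩
  exact ⟨(x, i), rfl⟩

/-- The number of positive roots outside of a translate of a symmetric set of roots does not
depend on the translate. -/
theorem ncard_posRoots_diff_image_le {A : Set (B →₀ ℝ)} (hA : ∀ β ∈ A, -β ∈ A) (g : T.Grp) :
    (T.posRoots \ (T.rep g '' A)).ncard ≤ (T.posRoots \ A).ncard := by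
  classical
  -- Pull back by `g` and correct the sign. This stays outside `A` by symmetry, and is injective
  -- because two positive roots are never opposite.
  let f : (B →₀ ℝ) → (B →₀ ℝ) := fun β ↦
    if ∀ b, 0 ≤ T.rep g⁻¹ β b then T.rep g⁻¹ β else -T.rep g⁻¹ β
  have hg : ∀ β, T.rep g (T.rep g⁻¹ β) = β := by
    intro β
    rw [← rep_mul_apply, mul_inv_cancel, map_one]
    rfl
  refine Set.ncard_le_ncard_of_injOn f ?_ ?_ (T.posRoots_finite.subset Set.sdiff_subset)
  · rintro β ⟨⟨h1, h2⟩, h3⟩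
    have hr : T.cs.IsRoot (T.rep g⁻¹ β) := T.isRoot_rep h1 _
    have hn : T.rep g⁻¹ β ∉ A := fun h ↦ h3 ⟨_, h, hg β⟩
    by_cases hp : ∀ b, 0 ≤ T.rep g⁻¹ β b
    · simp only [f, if_pos hp]
      exact ⟨⟨hr, hp⟩, hn⟩
    · simp only [f, if_neg hp]
      refine ⟨⟨hr.neg, fun b ↦ ?_⟩, fun h ↦ hn (by simpa using hA _ h)⟩
      have := hr.nonneg_or_nonpos.resolve_left hp b
      rw [Finsupp.neg_apply]
      linarith
  · rintro β ⟨⟨h1, h2⟩, -⟩ γ ⟨⟨h3, h4⟩, -⟩ h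
    have hrep : T.rep g (f β) = T.rep g (f γ) := congrArg _ h
    have hf : ∀ β, T.rep g (f β) = β ∨ T.rep g (f β) = -β := by
      intro β
      by_cases hp : ∀ b, 0 ≤ T.rep g⁻¹ β b
      · simp only [f, if_pos hp, hg, true_or]
      · simp only [f, if_neg hp, map_neg, hg, or_true]
    have key : ∀ {β γ : B →₀ ℝ}, T.cs.IsRoot β → (∀ b, 0 ≤ β b) → (∀ b, 0 ≤ γ b) →
        β ≠ -γ := by
      intro β γ hβ h h' e
      refine hβ.not_nonneg_and_nonpos h fun b ↦ ?_
      rw [e, Finsupp.neg_apply]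
      linarith [h' b]
    rcases hf β with e1 | e1 <;> rcases hf γ with e2 | e2 <;> rw [e1, e2] at hrep
    · exact hrep
    · exact (key h1 h2 h4 hrep).elim
    · exact (key h3 h4 h2 hrep.symm).elim
    · exact neg_injective hrep

/-! ### Deligne-Garside factors -/

theorem DG_succ_eq (b : T.Br) (n : ℕ) :
    T.DG b (n + 1) = T.cs.reducedBraid (T.cs.garsideHead (T.cs.garsideRest^[n] b.braid)) := by
  have e : T.remainder = T.cs.garsideRest := funext T.remainder_eq
  rw [DG, head_eq, e]

theorem DGprod_congr {b c : T.Br} {n : ℕ}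
    (h : ∀ j < n, T.cs.garsideHead (T.cs.garsideRest^[j] b.braid) =
      T.cs.garsideHead (T.cs.garsideRest^[j] c.braid)) : T.DGprod b n = T.DGprod c n := by
  induction n with
  | zero => rfl
  | succ n ih =>
    rw [DGprod, DGprod, ih fun j hj ↦ h j (by omega), DG_succ_eq, DG_succ_eq, h n (by omega)]

theorem iterate_garsideRest_mul_DGprod (b : T.Br) (n : ℕ) :
    T.cs.garsideRest^[n] b.braid * T.DGprod b n = b.braid := by
  induction n with
  | zero => exact mul_one _
  | succ n ih =>
    rw [DGprod, DG_succ_eq, Function.iterate_succ_apply', ← mul_assoc,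
      garsideRest_mul_garsideHead, ih]

/-- Pulled back through the first `n` factors, an inversion of the next factor is a root of the
whole power, hence not stable. -/
theorem invSet_DG_subset (w : T.Grp) (n d : ℕ) :
    T.invSet (T.ofBraid (T.DG (T.reducedBraid w ^ d) (n + 1))) ⊆ T.posRoots \
      (T.rep (T.ofBraid (T.DGprod (T.reducedBraid w ^ d) n)) '' T.stableRoots w) := by
  rw [DG_succ_eq, invSet_ofBraid_reducedBraid]
  intro γ hγ
  refine ⟨⟨hγ.1, hγ.2.1⟩, ?_⟩
  rintro ⟨β, hβ, rfl⟩
  refine T.notMem_stableRoots_of_mem_braidRoots (d := d) ?_ hβ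
  rw [← T.iterate_garsideRest_mul_DGprod _ n, mem_braidRoots_mul]
  left
  rw [← T.cs.garsideRest_mul_garsideHead (T.cs.garsideRest^[n] _), mem_braidRoots_mul]
  right
  rw [braidRoots_reducedBraid]
  rwa [ofBraid, rep_inl] at hγ

theorem len_DG_le (w : T.Grp) (n d : ℕ) :
    T.len (T.ofBraid (T.DG (T.reducedBraid w ^ d) (n + 1))) ≤
      (T.posRoots \ T.stableRoots w).ncard :=
  (Set.ncard_le_ncard (T.invSet_DG_subset w n d) (T.posRoots_finite.subset Set.sdiff_subset)).trans
    (T.ncard_posRoots_diff_image_le (fun _ ↦ T.neg_mem_stableRoots) _)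

theorem length_garsideHead_le (w : T.Grp) (n d : ℕ) :
    T.cs.length (T.cs.garsideHead (T.cs.garsideRest^[n] (T.reducedBraid w ^ d).braid)) ≤
      (T.posRoots \ T.stableRoots w).ncard := by
  have := T.len_DG_le w n d
  rwa [len, DG_succ_eq, invSet_ofBraid_reducedBraid, (T.cs.invRoots_finite_and_ncard _).2] at this

theorem invSet_subset_invSet_DG (w : T.Grp) (d : ℕ) :
    T.invSet w ⊆ T.invSet (T.ofBraid (T.DG (T.reducedBraid w ^ (d + 1)) 1)) := by
  rw [← zero_add 1, DG_succ_eq, invSet_ofBraid_reducedBraid, invSet_eq,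
    ← isSuffix_iff_invRoots_subset, ← reducedBraid_isRightDivisor_iff]
  exact ⟨_, T.braid_pow_succ _ d⟩

end Finite

/-! ### Stabilization of the factors. -/

/-- An orbit of `F` that stalls once is constant from there on. Until then `len` grows by at least
one per step, starting from `L` or more, and cannot exceed `N`. -/
theorem eq_of_stabilizing {α : Type*} {y : ℕ → α} {F : α → α} {len : α → ℕ} {L N : ℕ}
    (hF : ∀ n, y (n + 1) = F (y n)) (hlt : ∀ n, y n = y (n + 1) ∨ len (y n) < len (y (n + 1)))
    (hL : L ≤ len (y 0)) (hN : ∀ n, len (y n) ≤ N) {n : ℕ} (hn : N - L ≤ n) :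
    y n = y (N - L) := by
  have h : ∀ n, y n = y (n + 1) ∨ L + n < len (y (n + 1)) := by
    intro n
    induction n with
    | zero => exact (hlt 0).imp_right fun h ↦ by omega
    | succ n ih =>
      rcases ih with ih | ih
      · left
        rw [hF n, hF (n + 1), ← ih]
      · exact (hlt (n + 1)).imp_right fun h ↦ by omega
  induction n, hn using Nat.le_induction with
  | base => rfl
  | succ n hn ih =>
    rw [← ih]
    refine ((h n).resolve_right fun h ↦ ?_).symm
    have := hN (n + 1)
    omega

variable [Finite W]

theorem garsideHead_iterate_pow_eq (w : T.Grp) (i : ℕ) :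
    ∀ d, i * ((T.posRoots \ T.stableRoots w).ncard - T.len w + 1) ≤ d → ∀ j < i,
      T.cs.garsideHead (T.cs.garsideRest^[j] (T.reducedBraid w ^ d).braid) =
      T.cs.garsideHead (T.cs.garsideRest^[j] (T.reducedBraid w ^
        (i * ((T.posRoots \ T.stableRoots w).ncard - T.len w + 1))).braid) := by
  have hbound := T.length_garsideHead_le w
  have hsucc := T.braid_pow_succ (T.reducedBraid w)
  have hsucc' := T.exists_braid_pow_succ (T.reducedBraid w)
  have hbraid : (T.reducedBraid w).braid = T.cs.reducedBraid (T.untwisted w) := rfl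
  rw [hbraid] at hsucc hsucc'
  generalize (T.reducedBraid w).twist⁻¹ = δ at *
  rw [len_eq]
  generalize (T.posRoots \ T.stableRoots w).ncard = N at *
  generalize T.untwisted w = v at *
  generalize hc : (fun d ↦ (T.reducedBraid w ^ d).braid) = c
  have hc : ∀ d, (T.reducedBraid w ^ d).braid = c d := fun d ↦ congrFun hc d
  simp only [hc] at *
  induction i with
  | zero => intro d _ j hj; omega
  | succ i ih =>
    generalize ht : i * (N - T.cs.length v + 1) = t at *
    have ht' : (i + 1) * (N - T.cs.length v + 1) = t + 1 + (N - T.cs.length v) := by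
      rw [add_mul, ht]; ring
    rw [ht']
    set r : ℕ → M.BraidMonoid := fun d ↦ T.cs.garsideRest^[i] (c d) with hr
    -- The first `i` factors no longer change, so a factor added on the left passes unaltered to the
    -- remainder `r`.
    have hleft : ∀ d, t ≤ d → ∃ ε, r (d + 1) =
        T.twistBraid ε (T.cs.reducedBraid v) * r d := by
      intro d hd
      obtain ⟨ε, hε⟩ := hsucc' d
      refine ⟨ε, ?_⟩
      simp only [hr]
      rw [hε]
      apply T.cs.iterate_garsideRest_mul_of_garsideHead_eq
      intro j hj
      rw [← hε, ih d hd j hj, ih (d + 1) (by omega) j hj]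
    -- The carried element is computed from the stable factors at `t`, so one `z` serves all `d`.
    obtain ⟨z, hz⟩ : ∃ z, ∀ d, t ≤ d →
        r (d + 1) = T.twistBraid δ (r d) * T.cs.reducedBraid z := by
      refine ⟨T.cs.garsideCarry
        (fun j ↦ T.φ δ (T.cs.garsideHead (T.cs.garsideRest^[j] (c t)))) v i, fun d hd ↦ ?_⟩
      simp only [hr]
      rw [hsucc, T.cs.iterate_garsideRest_mul_reducedBraid, iterate_garsideRest_twistBraid]
      congr 2
      apply T.cs.garsideCarry_congr
      intro j hj
      rw [iterate_garsideRest_twistBraid, garsideHead_twistBraid, ih d hd j hj]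
    -- Both descriptions of `r (t + 1)` add one reduced braid to a braid as long as `r t`; compare
    -- braid lengths.
    have hzlen : T.cs.length z = T.cs.length v := by
      obtain ⟨ε, hε⟩ := hleft t le_rfl
      have e := congrArg braidLength ((hz t le_rfl).symm.trans hε)
      rw [map_mul, map_mul, braidLength_twistBraid, braidLength_twistBraid,
        braidLength_reducedBraid, braidLength_reducedBraid, mul_comm, mul_left_inj] at e
      exact Multiplicative.ofAdd.injective e
    have hstep : ∀ d, t ≤ d → T.cs.garsideHead (r (d + 1)) =
        T.cs.maxSuffix (T.φ δ (T.cs.garsideHead (r d))) z * z := by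
      intro d hd
      rw [hz d hd, garsideHead_mul_reducedBraid, garsideHead_twistBraid]
    have hmono : ∀ d, t ≤ d →
        T.cs.IsSuffix (T.cs.garsideHead (r d)) (T.cs.garsideHead (r (d + 1))) := by
      intro d hd
      obtain ⟨ε, hε⟩ := hleft d hd
      rw [← reducedBraid_isRightDivisor_iff, hε]
      refine ⟨T.twistBraid ε (T.cs.reducedBraid v) * T.cs.garsideRest (r d), ?_⟩
      rw [mul_assoc, garsideRest_mul_garsideHead]
    -- The count starts at `t + 1` because only after one step must the head end in `z` and so have
    -- length at least `ℓ(w)`; this is the `+ 1` in the exponent.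
    have hstab : ∀ n, N - T.cs.length v ≤ n → T.cs.garsideHead (r (t + 1 + n)) =
        T.cs.garsideHead (r (t + 1 + (N - T.cs.length v))) := by
      intro n hn
      refine eq_of_stabilizing (y := fun n ↦ T.cs.garsideHead (r (t + 1 + n)))
        (F := fun x ↦ T.cs.maxSuffix (T.φ δ x) z * z) (len := T.cs.length)
        (fun n ↦ hstep (t + 1 + n) (by omega)) (fun n ↦ ?_) ?_ (fun n ↦ hbound i _) hn
      · by_cases hle : T.cs.length (T.cs.garsideHead (r (t + 1 + (n + 1)))) ≤
            T.cs.length (T.cs.garsideHead (r (t + 1 + n)))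
        · exact .inl ((hmono (t + 1 + n) (by omega)).eq_of_length_le hle)
        · exact .inr (not_le.1 hle)
      · rw [← hzlen]
        change _ ≤ T.cs.length (T.cs.garsideHead (r (t + 1)))
        rw [hstep t le_rfl]
        exact (T.cs.isSuffix_maxSuffix_mul _ _).length_le
    intro d hd j hj
    rcases Nat.lt_succ_iff_lt_or_eq.1 hj with hj | rfl
    · rw [ih d (by omega) j hj, ih (t + 1 + (N - T.cs.length v)) (by omega) j hj]
    · obtain ⟨n, rfl⟩ : ∃ n, d = t + 1 + n := ⟨d - (t + 1), by omega⟩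
      exact hstab n (by omega)

end TwistedCoxeterSystem

theorem propositionA {B W Ω : Type*} [Group W] [Finite W] [Group Ω] {M : CoxeterMatrix B}
    (T : TwistedCoxeterSystem M W Ω) (w : T.Grp) :
    (∀ d : ℕ, 1 ≤ d →
      T.braidInvSet (T.reducedBraid w ^ d) ⊆ T.roots \ T.stableRoots w) ∧
    ∀ i : ℕ, 1 ≤ i →
      (∀ d : ℕ, 1 ≤ d →
        T.invSet (T.ofBraid (T.DG (T.reducedBraid w ^ d) i)) ⊆
            T.posRoots \ (T.rep (T.ofBraid (T.DGprod (T.reducedBraid w ^ d) (i - 1))) ''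
              T.stableRoots w) ∧
          T.invSet w ⊆ T.invSet (T.ofBraid (T.DG (T.reducedBraid w ^ d) 1)) ∧
          T.invSet (T.ofBraid (T.DG (T.reducedBraid w ^ d) 1)) ⊆
            T.posRoots \ T.stableRoots w ∧
          T.len (T.ofBraid (T.DG (T.reducedBraid w ^ d) i)) ≤
            (T.posRoots \ T.stableRoots w).ncard) ∧
      ∀ d : ℕ, d = i * ((T.posRoots \ T.stableRoots w).ncard - T.len w + 1) →
        ∀ d' : ℕ, d ≤ d' →
          T.DGprod (T.reducedBraid w ^ d') i = T.DGprod (T.reducedBraid w ^ d) i := by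
  refine ⟨fun d _ β hβ ↦ ?_, fun i hi ↦ ⟨fun d hd ↦ ?_, ?_⟩⟩
  · rw [T.mem_braidInvSet_iff] at hβ
    exact ⟨T.cs.isRoot_of_mem_braidRoots hβ, T.notMem_stableRoots_of_mem_braidRoots hβ⟩
  · obtain ⟨n, rfl⟩ : ∃ n, i = n + 1 := ⟨i - 1, by omega⟩
    obtain ⟨d, rfl⟩ : ∃ e, d = e + 1 := ⟨d - 1, by omega⟩
    refine ⟨T.invSet_DG_subset w n _, T.invSet_subset_invSet_DG w d, ?_, T.len_DG_le w n _⟩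
    -- For the first factor the translating product is empty, so the translate is the set of stable
    -- roots itself.
    have h := T.invSet_DG_subset w 0 (d + 1)
    have e : T.rep (T.ofBraid (T.DGprod (T.reducedBraid w ^ (d + 1)) 0)) '' T.stableRoots w =
        T.stableRoots w := by
      have e1 : T.ofBraid (T.DGprod (T.reducedBraid w ^ (d + 1)) 0) = 1 := by
        rw [TwistedCoxeterSystem.DGprod, TwistedCoxeterSystem.ofBraid, map_one, map_one]
      rw [e1, map_one]
      exact Set.image_id _
    rwa [e] at h
  · rintro d rfl d' hd'
    exact T.DGprod_congr (T.garsideHead_iterate_pow_eq w i d' hd')
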